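/- **Setting.** Let $\mathcal G=SL(2,\mathbb R)\times SL(2,\mathbb R)$ and $R(\theta)=\begin{pmatrix}\cos\theta&\sin\theta\\-\sin\theta&\cos\theta\end{pmatrix}$. Let $N\ge 1$ be an odd integer and let $q,p$ be odd coprime integers. Put $$\varepsilon_i(\theta)=\bigl(R(q\theta),\,R(p\theta+\tfrac{2\pi}{N}i)\bigr),\qquad H=H(N,q,p)=\{\varepsilon_i(\theta):\theta\in\mathbb R,\ i=0,\dots,N-1\}\subset\mathcal G ,$$ so that $H(1,q,p)=S^1_{(q,p)}$. For a closed subgroup $S\subseteq\mathcal G$ let $\mathrm{Ad}_S$ denote the adjoint representation of $S$ on its Lie algebra $\{X\in M_2(\mathbb R)^2: \exp(tX)\in S\ \forall t\in\mathbb R\}$. Let $\Omega_j=(A_j,0)$, $\Omega_{3+j}=(0,A_j)$, $j=1,2,3$, with $$A_1=\begin{pmatrix}0&1\\1&0\end{pmatrix},\quad A_2=\begin{pmatrix}1&0\\0&-1\end{pmatrix},\quad A_3=\begin{pmatrix}0&1\\-1&0\end{pmatrix}.$$ Let $\lambda$ be the $SO(2)\times SO(2)$-invariant measure $\frac{dx}{1+x^2}\frac{dy}{1+y^2}$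 on the torus $\mathcal P=P_1(\mathbb R)\times P_1(\mathbb R)$ in affine coordinates $(x,y)$. For $g=\begin{pmatrix}a&b\\c&d\end{pmatrix}$ put $$xg=\frac{xa+c}{xb+d},\qquad k_g(x)=\Bigl(\frac{(xb+d)^2+(xa+c)^2}{1+x^2}\Bigr)^{1/2},\qquad s_g(x)=\frac{xb+d}{|xb+d|}.$$ The dual action of $\mathcal G$ on $L^2(\mathcal P,\lambda,\mathbb R)$ (identified with its topological dual) is $$(T'(g,h)\phi)(x,y)=k_g(x)^{-3}s_g(x)\,k_h(y)^{-3}s_h(y)\,\phi(xg,yh),$$ and the little group of $\phi$ is its stabilizer $L_\phi$. **Claim.** 1. The $\Omega_j$ form a basis of the Lie algebra of $\mathcal G$, and for all $i,\theta$, with $\alpha=q\theta$ and $\beta=p\theta+\frac{2\pi}{N}i$, one has $\mathrm{Ad}_{\mathcal G}(\varepsilon_i(\theta))\,\Omega_j=\sum_k M_{jk}\Omega_k$, where $$M=\begin{pmatrix}B(\alpha)&0\\0&B(\beta)\end{pmatrix},\qquad B(\alpha)=\begin{pmatrix}\cos2\alpha&\sin2\alpha&0\\-\sin2\alpha&\cos2\alpha&0\\0&0&1\end{pmatrix}.$$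 For every $h\in H$, $\det\mathrm{Ad}_{\mathcal G}(h)=1$ and $\mathrm{Ad}_H(h)$ is the identity, so $|\det\mathrm{Ad}_{\mathcal G}(h)|=|\det\mathrm{Ad}_H(h)|$. 2. The measure $\nu$ on $H$ given by $\int_H f\,d\nu=\frac1N\sum_{i=0}^{N-1}\frac1{2\pi}\int_0^{2\pi}f(\varepsilon_i(\theta))\,d\theta$ is the normalised Haar measure of $H$. 3. For every Haar measure $\mu$ on $\mathcal G$ there is a non-zero regular Borel measure $m$ on $\mathcal G/H$, invariant under left translation by $\mathcal G$, such that $$\int_{\mathcal G}f\,d\mu=\int_{\mathcal G/H}\Bigl(\int_H f(gh)\,d\nu(h)\Bigr)dm(gH)\qquad\text{for all } f\in C_c(\mathcal G,\mathbb R),$$ where the inner integral is a continuous compactly supported function of $gH$. Every $\mathcal G$-invariant regular Borel measure on $\mathcal G/H$ is a multiple $c\,m$ with $c\ge 0$. 4. $\mathcal G/H$ is homeomorphic to $\mathbb R^4\times S^1$. For every $\phi\in L^2(\mathcal P,\lambda,\mathbb R)$ with $L_\phi=H$, the orbit $\mathcal G\phi$ of the dual action, with the topology induced by the norm of $L^2$,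 is homeomorphic to $\mathbb R^4\times S^1$. In particular this holds for orbits with little group $S^1_{(q,p)}$. -/

import Mathlib

open MeasureTheory Matrix
open scoped ENNReal MatrixGroups

noncomputable section

/-- The group `𝒢 = SL(2,ℝ) × SL(2,ℝ)`. -/
abbrev SLxSL : Type := SL(2, ℝ) × SL(2, ℝ)

instance instMeasurableSpaceSL2R : MeasurableSpace SL(2, ℝ) := borel _

instance instBorelSpaceSL2R : BorelSpace SL(2, ℝ) := ⟨rfl⟩

instance instSecondCountableTopologySL2R : SecondCountableTopology SL(2, ℝ) :=
  haveI : SecondCountableTopology (Matrix (Fin 2) (Fin 2) ℝ) :=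
    inferInstanceAs (SecondCountableTopology (Fin 2 → Fin 2 → ℝ))
  TopologicalSpace.Subtype.secondCountableTopology {A : Matrix (Fin 2) (Fin 2) ℝ | A.det = 1}

/-! ### The groups `H(N,q,p)` -/

/-- The rotation `[[cos θ, sin θ], [-sin θ, cos θ]]`. -/
def rot (θ : ℝ) : SL(2, ℝ) :=
  ⟨!![Real.cos θ, Real.sin θ; -Real.sin θ, Real.cos θ], by
    rw [Matrix.det_fin_two_of]; nlinarith [Real.sin_sq_add_cos_sq θ]⟩

lemma rot_add (a b : ℝ) : rot (a + b) = rot a * rot b := by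
  apply Subtype.ext
  rw [Matrix.SpecialLinearGroup.coe_mul]
  ext i j
  fin_cases i <;> fin_cases j <;>
    simp [rot, Matrix.mul_apply, Fin.sum_univ_two, Real.cos_add, Real.sin_add] <;> ring

lemma rot_zero : rot 0 = 1 := by
  apply Subtype.ext
  ext i j
  fin_cases i <;> fin_cases j <;> simp [rot]

lemma rot_neg (a : ℝ) : rot (-a) = (rot a)⁻¹ := by
  rw [eq_inv_iff_mul_eq_one, ← rot_add, neg_add_cancel, rot_zero]

/-- The element `(R(qθ), R(pθ + 2πi/N))`; it depends on `i` only modulo `N`. -/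
def littleElt (N : ℕ) (q p : ℤ) (i : ℤ) (θ : ℝ) : SLxSL :=
  (rot (q * θ), rot (p * θ + 2 * Real.pi / N * i))

lemma littleElt_add (N : ℕ) (q p i j : ℤ) (θ η : ℝ) :
    littleElt N q p (i + j) (θ + η) = littleElt N q p i θ * littleElt N q p j η := by
  simp only [littleElt, Prod.mk_mul_mk, ← rot_add]
  congr 2 <;> push_cast <;> ring

lemma littleElt_zero (N : ℕ) (q p : ℤ) : littleElt N q p 0 0 = 1 := by
  simp [littleElt, rot_zero]

/-- The group `H(N,q,p) = {(R(qθ), R(pθ + 2πi/N))}`. In particular `H(1,q,p)` is the circle group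
`S¹_(q,p)`. -/
def littleGroup (N : ℕ) (q p : ℤ) : Subgroup SLxSL where
  carrier := {g | ∃ (i : ℤ) (θ : ℝ), g = littleElt N q p i θ}
  mul_mem' := by
    rintro _ _ ⟨i, θ, rfl⟩ ⟨j, η, rfl⟩
    exact ⟨i + j, θ + η, (littleElt_add N q p i j θ η).symm⟩
  one_mem' := ⟨0, 0, (littleElt_zero N q p).symm⟩
  inv_mem' := by
    rintro _ ⟨i, θ, rfl⟩
    refine ⟨-i, -θ, ?_⟩
    rw [inv_eq_iff_mul_eq_one, ← littleElt_add, add_neg_cancel, add_neg_cancel, littleElt_zero]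

/-- `littleElt` as an element of the group `H(N,q,p)`. -/
def littleMk (N : ℕ) (q p : ℤ) (i : ℤ) (θ : ℝ) : littleGroup N q p :=
  ⟨littleElt N q p i θ, i, θ, rfl⟩

/-- The measure `N⁻¹ ∑_{i < N} dθ / 2π` (with `0 < θ ≤ 2π`) on `H(N,q,p)`. -/
def littleMeasure (N : ℕ) (q p : ℤ) : Measure (littleGroup N q p) :=
  (N : ℝ≥0∞)⁻¹ • ∑ i : Fin N, ((ENNReal.ofReal (2 * Real.pi))⁻¹ •
    (volume.restrict (Set.Ioc (0 : ℝ) (2 * Real.pi))).map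
      (fun θ => littleMk N q p ((i : ℕ) : ℤ) θ))

/-- The coset space `𝒢 / H(N,q,p)` with the quotient topology and its Borel `σ`-algebra. -/
def LittleQuotient (N : ℕ) (q p : ℤ) : Type := SLxSL ⧸ littleGroup N q p

instance (N : ℕ) (q p : ℤ) : TopologicalSpace (LittleQuotient N q p) :=
  inferInstanceAs (TopologicalSpace (SLxSL ⧸ littleGroup N q p))

instance (N : ℕ) (q p : ℤ) : MeasurableSpace (LittleQuotient N q p) := borel _

instance (N : ℕ) (q p : ℤ) : BorelSpace (LittleQuotient N q p) := ⟨rfl⟩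

/-- Left translation of cosets. -/
instance (N : ℕ) (q p : ℤ) : MulAction SLxSL (LittleQuotient N q p) :=
  inferInstanceAs (MulAction SLxSL (SLxSL ⧸ littleGroup N q p))

/-- The coset `g H(N,q,p)`. -/
def LittleQuotient.mk (N : ℕ) (q p : ℤ) (g : SLxSL) : LittleQuotient N q p :=
  (QuotientGroup.mk g : SLxSL ⧸ littleGroup N q p)

/-! ### Lie algebras and adjoint representations -/

/-- The algebra `M₂(ℝ) × M₂(ℝ)` (block diagonal `4 × 4` matrices) that contains `𝒢`. -/
abbrev MatPair : Type := Matrix (Fin 2) (Fin 2) ℝ × Matrix (Fin 2) (Fin 2) ℝ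

/-- Those `X` all of whose exponentials `exp (tX)` lie in the subgroup `S`. -/
def expSet (S : Subgroup SLxSL) : Set MatPair :=
  {X | ∀ t : ℝ, ∃ s ∈ S, NormedSpace.exp (t • X.1) = (s.1 : Matrix (Fin 2) (Fin 2) ℝ) ∧
    NormedSpace.exp (t • X.2) = (s.2 : Matrix (Fin 2) (Fin 2) ℝ)}

/-- The Lie algebra of a closed subgroup `S` of `𝒢`, realised in `M₂(ℝ) × M₂(ℝ)`. For closed `S` the
set `expSet S` is already a linear subspace, so that taking the span adds nothing. -/
def lieAlg (S : Subgroup SLxSL) : Submodule ℝ MatPair := Submodule.span ℝ (expSet S)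

/-- Conjugation `X ↦ g X g⁻¹`. -/
def conjPair (g : SLxSL) : MatPair →ₗ[ℝ] MatPair where
  toFun X := ((g.1 : Matrix (Fin 2) (Fin 2) ℝ) * X.1 * (g.1⁻¹ : SL(2, ℝ)),
    (g.2 : Matrix (Fin 2) (Fin 2) ℝ) * X.2 * (g.2⁻¹ : SL(2, ℝ)))
  map_add' X Y := by simp [Matrix.mul_add, Matrix.add_mul]
  map_smul' c X := by simp

lemma exp_conj_SL (g : SL(2, ℝ)) (X : Matrix (Fin 2) (Fin 2) ℝ) :
    NormedSpace.exp ((g : Matrix (Fin 2) (Fin 2) ℝ) * X * (g⁻¹ : SL(2, ℝ))) =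
      (g : Matrix (Fin 2) (Fin 2) ℝ) * NormedSpace.exp X * (g⁻¹ : SL(2, ℝ)) := by
  have h1 : IsUnit (g : Matrix (Fin 2) (Fin 2) ℝ) := by
    rw [Matrix.isUnit_iff_isUnit_det]; simp
  have h2 : ((g⁻¹ : SL(2, ℝ)) : Matrix (Fin 2) (Fin 2) ℝ) =
      (g : Matrix (Fin 2) (Fin 2) ℝ)⁻¹ := by
    rw [Matrix.SpecialLinearGroup.coe_inv, Matrix.inv_def]; simp
  rw [h2, Matrix.exp_conj _ _ h1]

lemma conjPair_mem (S : Subgroup SLxSL) (s : S) (X : MatPair) (hX : X ∈ lieAlg S) :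
    conjPair s X ∈ lieAlg S := by
  have key : lieAlg S ≤ (lieAlg S).comap (conjPair s) := by
    refine Submodule.span_le.2 fun X hX => Submodule.subset_span fun t => ?_
    obtain ⟨u, hu, h1, h2⟩ := hX t
    refine ⟨s * u * s⁻¹, S.mul_mem (S.mul_mem s.2 hu) (S.inv_mem s.2), ?_, ?_⟩
    · change NormedSpace.exp (t • (((s : SLxSL).1 : Matrix (Fin 2) (Fin 2) ℝ) * X.1 *
        ((s : SLxSL).1⁻¹ : SL(2, ℝ)))) = _
      rw [← Matrix.smul_mul, ← Matrix.mul_smul, exp_conj_SL, h1]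
      simp
    · change NormedSpace.exp (t • (((s : SLxSL).2 : Matrix (Fin 2) (Fin 2) ℝ) * X.2 *
        ((s : SLxSL).2⁻¹ : SL(2, ℝ)))) = _
      rw [← Matrix.smul_mul, ← Matrix.mul_smul, exp_conj_SL, h2]
      simp
  exact key hX

/-- The adjoint representation of the subgroup `S` on its Lie algebra. -/
def AdRep (S : Subgroup SLxSL) (s : S) : lieAlg S →ₗ[ℝ] lieAlg S :=
  (conjPair s).restrict (conjPair_mem S s)

/-- `Ad_𝒢 (g)`, the adjoint representation of the whole group. -/
def AdG (g : SLxSL) : lieAlg ⊤ →ₗ[ℝ] lieAlg ⊤ := AdRep ⊤ ⟨g, Subgroup.mem_top g⟩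

/-- The matrices `A₁, A₂, A₃` (indexed from `0`). -/
def basisSl2 : Fin 3 → Matrix (Fin 2) (Fin 2) ℝ :=
  ![!![0, 1; 1, 0], !![1, 0; 0, -1], !![0, 1; -1, 0]]

/-- The generators `Ω₁, Ω₂, Ω₃` (left summand) and `Ω₄, Ω₅, Ω₆` (right summand). -/
def generator : Fin 3 ⊕ Fin 3 → MatPair :=
  Sum.elim (fun i => (basisSl2 i, 0)) (fun i => (0, basisSl2 i))

/-- The block `[[cos 2α, sin 2α, 0], [-sin 2α, cos 2α, 0], [0, 0, 1]]`. -/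
def adBlock (α : ℝ) : Matrix (Fin 3) (Fin 3) ℝ :=
  !![Real.cos (2 * α), Real.sin (2 * α), 0; -Real.sin (2 * α), Real.cos (2 * α), 0; 0, 0, 1]

/-! ### The dual action on `L²(𝒫, λ, ℝ)` -/

/-- The rotation invariant measure `dx / (1 + x²)` on the projective line, in the affine coordinate
`x = x₁ / x₂`; the point at infinity is a null set. -/
def lineMeasure : Measure ℝ := volume.withDensity (fun x => ENNReal.ofReal (1 + x ^ 2)⁻¹)

/-- The measure `λ` on the torus `𝒫 = P₁(ℝ) × P₁(ℝ)`, in the affine coordinates `(x, y)`. -/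
def torusMeasure : Measure (ℝ × ℝ) := lineMeasure.prod lineMeasure

/-- The numerator `xa + c` of `xg`. -/
def numF (g : SL(2, ℝ)) (x : ℝ) : ℝ := x * g 0 0 + g 1 0

/-- The denominator `xb + d` of `xg`. -/
def denF (g : SL(2, ℝ)) (x : ℝ) : ℝ := x * g 0 1 + g 1 1

/-- The fractional linear right action `xg = (xa + c) / (xb + d)`. -/
def mob (g : SL(2, ℝ)) (x : ℝ) : ℝ := numF g x / denF g x

/-- `k_g(x) = (((xb + d)² + (xa + c)²) / (1 + x²))^(1/2)`. -/
def kF (g : SL(2, ℝ)) (x : ℝ) : ℝ := Real.sqrt ((denF g x ^ 2 + numF g x ^ 2) / (1 + x ^ 2))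

/-- `s_g(x) = (xb + d) / |xb + d|`. -/
def sF (g : SL(2, ℝ)) (x : ℝ) : ℝ := denF g x / |denF g x|

/-- The multiplier `k_g(x)⁻³ s_g(x)`. -/
def multF (g : SL(2, ℝ)) (x : ℝ) : ℝ := (kF g x ^ 3)⁻¹ * sF g x

/-- The function `(x, y) ↦ k_g(x)⁻³ s_g(x) k_h(y)⁻³ s_h(y) φ(xg, yh)`. -/
def dualFun (g : SLxSL) (φ : ℝ × ℝ → ℝ) (z : ℝ × ℝ) : ℝ :=
  multF g.1 z.1 * multF g.2 z.2 * φ (mob g.1 z.1, mob g.2 z.2)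

lemma det_SL (g : SL(2, ℝ)) : g 0 0 * g 1 1 - g 0 1 * g 1 0 = 1 := by
  have := g.2
  rwa [Matrix.det_fin_two] at this

lemma num_den_pos (g : SL(2, ℝ)) (x : ℝ) : 0 < denF g x ^ 2 + numF g x ^ 2 := by
  have h := det_SL g
  have e : denF g x * g 0 0 - numF g x * g 0 1 = 1 := by
    simp only [denF, numF]; linear_combination h
  by_contra hc
  have h1 : denF g x = 0 := by nlinarith [sq_nonneg (denF g x), sq_nonneg (numF g x)]
  have h2 : numF g x = 0 := by nlinarith [sq_nonneg (denF g x), sq_nonneg (numF g x)]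
  simp [h1, h2] at e

lemma kF_sq (g : SL(2, ℝ)) (x : ℝ) :
    kF g x ^ 2 = (denF g x ^ 2 + numF g x ^ 2) / (1 + x ^ 2) :=
  Real.sq_sqrt (div_nonneg (num_den_pos g x).le (by positivity))

lemma kF_pos (g : SL(2, ℝ)) (x : ℝ) : 0 < kF g x :=
  Real.sqrt_pos.2 (div_pos (num_den_pos g x) (by positivity))

lemma measurable_numF (g : SL(2, ℝ)) : Measurable (numF g) := by unfold numF; fun_prop
lemma measurable_denF (g : SL(2, ℝ)) : Measurable (denF g) := by unfold denF; fun_prop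
lemma measurable_mob (g : SL(2, ℝ)) : Measurable (mob g) :=
  (measurable_numF g).div (measurable_denF g)
lemma measurable_kF (g : SL(2, ℝ)) : Measurable (kF g) := by
  have := measurable_numF g
  have := measurable_denF g
  unfold kF; fun_prop
lemma measurable_multF (g : SL(2, ℝ)) : Measurable (multF g) := by
  have h1 := measurable_kF g
  have h2 := measurable_denF g
  unfold multF sF
  exact (h1.pow_const 3).inv.mul (h2.div (measurable_norm.comp h2))

/-- The bound `k_g⁻² ≤ a² + b² + c² + d²`. -/
lemma kF_inv_sq_le (g : SL(2, ℝ)) (x : ℝ) :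
    (kF g x ^ 2)⁻¹ ≤ g 0 0 ^ 2 + g 0 1 ^ 2 + g 1 0 ^ 2 + g 1 1 ^ 2 := by
  have h := det_SL g
  have e1 : denF g x * g 0 0 - numF g x * g 0 1 = 1 := by
    simp only [denF, numF]; linear_combination h
  have e2 : numF g x * g 1 1 - denF g x * g 1 0 = x := by
    simp only [denF, numF]; linear_combination x * h
  rw [kF_sq, inv_div, div_le_iff₀ (num_den_pos g x)]
  have : 1 + x ^ 2 = (denF g x * g 0 0 - numF g x * g 0 1) ^ 2 +
      (numF g x * g 1 1 - denF g x * g 1 0) ^ 2 := by rw [e1, e2]; ring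
  rw [this]
  nlinarith [sq_nonneg (denF g x * g 0 1 + numF g x * g 0 0),
    sq_nonneg (denF g x * g 1 1 + numF g x * g 1 0)]

lemma sF_sq_le (g : SL(2, ℝ)) (x : ℝ) : sF g x ^ 2 ≤ 1 := by
  unfold sF
  rw [div_pow, sq_abs]
  exact div_self_le_one _

lemma finite_denF_zero (g : SL(2, ℝ)) : {x | denF g x = 0}.Finite := by
  have h := det_SL g
  refine Set.Subsingleton.finite fun x hx y hy => ?_
  change x * g 0 1 + g 1 1 = 0 at hx
  change y * g 0 1 + g 1 1 = 0 at hy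
  have h1 : (x - y) * g 0 1 = 0 := by linear_combination hx - hy
  rcases mul_eq_zero.1 h1 with h2 | h2
  · linarith
  · rw [h2] at hx h
    have : g 1 1 = 0 := by linarith
    rw [this] at h
    simp at h

lemma ae_denF_ne_zero (g : SL(2, ℝ)) : ∀ᵐ x ∂(volume : Measure ℝ), denF g x ≠ 0 := by
  rw [ae_iff]
  simpa using (finite_denF_zero g).measure_zero volume

lemma lineMeasure_ac : lineMeasure ≪ volume := withDensity_absolutelyContinuous _ _

instance : SFinite lineMeasure := by unfold lineMeasure; infer_instance
instance : SFinite torusMeasure := by unfold torusMeasure; infer_instance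

lemma ae_torus_denF (g : SLxSL) :
    ∀ᵐ z ∂torusMeasure, denF g.1 z.1 ≠ 0 ∧ denF g.2 z.2 ≠ 0 := by
  have h1 : ∀ᵐ z ∂torusMeasure, denF g.1 z.1 ≠ 0 :=
    Measure.quasiMeasurePreserving_fst.ae (lineMeasure_ac.ae_le (ae_denF_ne_zero g.1))
  have h2 : ∀ᵐ z ∂torusMeasure, denF g.2 z.2 ≠ 0 :=
    Measure.quasiMeasurePreserving_snd.ae (lineMeasure_ac.ae_le (ae_denF_ne_zero g.2))
  exact h1.and h2

lemma num_mul (g h : SL(2, ℝ)) (x : ℝ) (hx : denF g x ≠ 0) :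
    numF (g * h) x = denF g x * numF h (mob g x) := by
  simp only [numF, Matrix.SpecialLinearGroup.coe_mul, Matrix.mul_apply, Fin.sum_univ_two, mob]
  field_simp
  simp only [denF]; ring

lemma den_mul (g h : SL(2, ℝ)) (x : ℝ) (hx : denF g x ≠ 0) :
    denF (g * h) x = denF g x * denF h (mob g x) := by
  have : denF (g * h) x = numF g x * h 0 1 + denF g x * h 1 1 := by
    simp only [denF, numF, Matrix.SpecialLinearGroup.coe_mul, Matrix.mul_apply, Fin.sum_univ_two]
    ring
  rw [this]
  simp only [denF, mob]
  simp only [denF] at hx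
  field_simp

lemma mob_mul (g h : SL(2, ℝ)) (x : ℝ) (hx : denF g x ≠ 0) :
    mob (g * h) x = mob h (mob g x) := by
  conv_lhs => rw [mob, num_mul g h x hx, den_mul g h x hx, mul_div_mul_left _ _ hx]
  rfl

lemma one_add_mob_sq (g : SL(2, ℝ)) (x : ℝ) (hx : denF g x ≠ 0) :
    1 + mob g x ^ 2 = (denF g x ^ 2 + numF g x ^ 2) / denF g x ^ 2 := by
  rw [mob]; field_simp

lemma kF_mul (g h : SL(2, ℝ)) (x : ℝ) (hx : denF g x ≠ 0) :
    kF (g * h) x = kF g x * kF h (mob g x) := by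
  unfold kF
  rw [← Real.sqrt_mul (div_nonneg (num_den_pos g x).le (by positivity)),
    num_mul g h x hx, den_mul g h x hx, one_add_mob_sq g x hx]
  congr 1
  have := (num_den_pos g x).ne'
  have : (1 + x ^ 2) ≠ 0 := by positivity
  field_simp

lemma multF_mul (g h : SL(2, ℝ)) (x : ℝ) (hx : denF g x ≠ 0) :
    multF (g * h) x = multF g x * multF h (mob g x) := by
  unfold multF sF
  rw [kF_mul g h x hx, den_mul g h x hx, abs_mul, mul_div_mul_comm, mul_pow, mul_inv]
  ring

lemma multF_one (x : ℝ) : multF 1 x = 1 := by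
  have h1 : denF 1 x = 1 := by simp [denF]
  have h2 : numF 1 x = x := by simp [numF]
  have h3 : (1 + x ^ 2) ≠ 0 := by positivity
  simp [multF, sF, kF, h1, h2, div_self h3]

lemma mob_one (x : ℝ) : mob 1 x = x := by simp [mob, denF, numF]

/-- The change of variables `λ(xg) = k_g(x)⁻² λ(x)` on the projective line. -/
lemma map_mob (g : SL(2, ℝ)) :
    (lineMeasure.withDensity (fun x => ENNReal.ofReal (kF g x ^ 2)⁻¹)).map (mob g) =
      lineMeasure := by
  have hk : Measurable (fun x => ENNReal.ofReal (kF g x ^ 2)⁻¹) :=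
    ((measurable_kF g).pow_const 2).inv.ennreal_ofReal
  have hl : Measurable (fun x : ℝ => ENNReal.ofReal (1 + x ^ 2)⁻¹) := by fun_prop
  have hdet := det_SL g
  refine Measure.ext_of_lintegral _ fun f hf => ?_
  have hfm : Measurable (fun x => f (mob g x)) := hf.comp (measurable_mob g)
  rw [lintegral_map hf (measurable_mob g), lintegral_withDensity_eq_lintegral_mul _ hk hfm,
    lineMeasure, lintegral_withDensity_eq_lintegral_mul _ hl (hk.mul hfm),
    lintegral_withDensity_eq_lintegral_mul _ hl hf]
  set s : Set ℝ := {x | denF g x ≠ 0} with hs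
  have hsm : MeasurableSet s := (measurableSet_eq_fun (measurable_denF g) measurable_const).compl
  have hder : ∀ x ∈ s, HasDerivWithinAt (mob g) ((denF g x ^ 2)⁻¹) s x := by
    intro x hx
    have hn : HasDerivAt (numF g) (g 0 0) x := by
      exact (((hasDerivAt_id x).mul_const (g 0 0)).add_const (g 1 0)).congr_deriv (one_mul _)
    have hd : HasDerivAt (denF g) (g 0 1) x := by
      exact (((hasDerivAt_id x).mul_const (g 0 1)).add_const (g 1 1)).congr_deriv (one_mul _)
    have := (hn.div hd hx).hasDerivWithinAt (s := s)
    refine this.congr_deriv ?_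
    rw [inv_eq_one_div]
    congr 1
    simp only [numF, denF]; linear_combination hdet
  have hback : ∀ x ∈ s, g 0 0 - mob g x * g 0 1 = (denF g x)⁻¹ := by
    intro x hx
    have hx' : denF g x ≠ 0 := hx
    rw [mob]; field_simp
    simp only [numF, denF]; linear_combination hdet
  have hinj : Set.InjOn (mob g) s := by
    intro x hx y hy hxy
    have h1 := hback x hx
    have h2 := hback y hy
    rw [hxy, h2] at h1
    have h3 : denF g y = denF g x := inv_injective h1
    have h4 : numF g x = numF g y := by
      have hx' : denF g x ≠ 0 := hx
      have hy' : denF g y ≠ 0 := hy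
      have : numF g x / denF g x = numF g y / denF g y := hxy
      rw [h3] at this
      exact (div_left_inj' hx').1 this
    simp only [numF, denF] at h3 h4
    linear_combination (g 1 1) * h4 + (g 1 0) * h3 - (x - y) * hdet
  have himg : (mob g '' s)ᶜ ⊆ {z | denF g⁻¹ z = 0} := by
    intro z hz
    by_contra hne
    apply hz
    have hne' : denF g⁻¹ z ≠ 0 := hne
    have hd : denF g⁻¹ z * denF g (mob g⁻¹ z) = 1 := by
      rw [← den_mul g⁻¹ g z hne', inv_mul_cancel]; simp [denF]
    refine ⟨mob g⁻¹ z, ?_, ?_⟩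
    · exact right_ne_zero_of_mul_eq_one hd
    · rw [← mob_mul g⁻¹ g z hne', inv_mul_cancel, mob_one]
  have hnull : volume (mob g '' s)ᶜ = 0 :=
    measure_mono_null himg ((finite_denF_zero g⁻¹).measure_zero volume)
  have hsnull : volume sᶜ = 0 := by
    have : sᶜ = {x | denF g x = 0} := by ext; simp [hs]
    rw [this]; exact (finite_denF_zero g).measure_zero volume
  have e1 : (volume : Measure ℝ).restrict s = volume :=
    Measure.restrict_eq_self_of_ae_mem (mem_ae_iff.2 hsnull)
  have e2 : (volume : Measure ℝ).restrict (mob g '' s) = volume :=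
    Measure.restrict_eq_self_of_ae_mem (mem_ae_iff.2 hnull)
  have main := lintegral_image_eq_lintegral_abs_deriv_mul hsm hder hinj
    (fun x => ENNReal.ofReal (1 + x ^ 2)⁻¹ * f x)
  rw [e2] at main
  simp only [Pi.mul_apply]
  rw [main]
  conv_lhs => rw [← e1]
  refine setLIntegral_congr_fun hsm fun x hx => ?_
  have hx' : denF g x ≠ 0 := hx
  rw [← mul_assoc, ← mul_assoc, ← ENNReal.ofReal_mul (by positivity),
    ← ENNReal.ofReal_mul (by positivity)]
  congr 2
  rw [kF_sq, one_add_mob_sq g x hx', abs_of_pos (by positivity)]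
  have := (num_den_pos g x).ne'
  field_simp

/-- The density `(k_g(x) k_h(y))⁻²`. -/
def dens (g : SLxSL) (z : ℝ × ℝ) : ℝ := (kF g.1 z.1 ^ 2)⁻¹ * (kF g.2 z.2 ^ 2)⁻¹

lemma dens_pos (g : SLxSL) (z : ℝ × ℝ) : 0 < dens g z :=
  mul_pos (inv_pos.2 (pow_pos (kF_pos _ _) 2)) (inv_pos.2 (pow_pos (kF_pos _ _) 2))

lemma measurable_dens (g : SLxSL) : Measurable (dens g) :=
  ((((measurable_kF g.1).comp measurable_fst).pow_const 2).inv).mul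
    ((((measurable_kF g.2).comp measurable_snd).pow_const 2).inv)

/-- The right action on the torus, in affine coordinates. -/
def mobPair (g : SLxSL) : ℝ × ℝ → ℝ × ℝ := Prod.map (mob g.1) (mob g.2)

lemma measurePreserving_mobPair (g : SLxSL) :
    MeasurePreserving (mobPair g) (torusMeasure.withDensity (fun z => ENNReal.ofReal (dens g z)))
      torusMeasure := by
  refine ⟨(measurable_mob g.1).prodMap (measurable_mob g.2), ?_⟩
  have hk : ∀ g : SL(2, ℝ), Measurable (fun x => ENNReal.ofReal (kF g x ^ 2)⁻¹) := fun g =>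
    ((measurable_kF g).pow_const 2).inv.ennreal_ofReal
  have e : torusMeasure.withDensity (fun z => ENNReal.ofReal (dens g z)) =
      (lineMeasure.withDensity (fun x => ENNReal.ofReal (kF g.1 x ^ 2)⁻¹)).prod
        (lineMeasure.withDensity (fun x => ENNReal.ofReal (kF g.2 x ^ 2)⁻¹)) := by
    rw [prod_withDensity (hk g.1) (hk g.2), torusMeasure]
    congr 1
    ext z
    rw [dens, ENNReal.ofReal_mul (by positivity)]
  rw [e, mobPair, ← Measure.map_prod_map _ _ (measurable_mob g.1) (measurable_mob g.2), map_mob,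
    map_mob, torusMeasure]

lemma quasi_mobPair (g : SLxSL) :
    Measure.QuasiMeasurePreserving (mobPair g) torusMeasure torusMeasure := by
  have h : torusMeasure ≪ torusMeasure.withDensity (fun z => ENNReal.ofReal (dens g z)) :=
    withDensity_absolutelyContinuous' (measurable_dens g).ennreal_ofReal.aemeasurable
      (Filter.Eventually.of_forall fun z => by simpa using dens_pos g z)
  exact (measurePreserving_mobPair g).quasiMeasurePreserving.mono_left h

lemma memLp_dualFun (g : SLxSL) {φ : ℝ × ℝ → ℝ} (hφ : MemLp φ 2 torusMeasure) :
    MemLp (dualFun g φ) 2 torusMeasure := by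
  have hM : Measurable (fun z : ℝ × ℝ => multF g.1 z.1 * multF g.2 z.2) :=
    ((measurable_multF g.1).comp measurable_fst).mul ((measurable_multF g.2).comp measurable_snd)
  have hmeas : AEStronglyMeasurable (dualFun g φ) torusMeasure :=
    hM.aestronglyMeasurable.mul (hφ.1.comp_quasiMeasurePreserving (quasi_mobPair g))
  rw [memLp_two_iff_integrable_sq hmeas]
  have h1 := ((memLp_two_iff_integrable_sq
    (hφ.comp_measurePreserving (measurePreserving_mobPair g)).1).1
    (hφ.comp_measurePreserving (measurePreserving_mobPair g)))
  rw [integrable_withDensity_iff (measurable_dens g).ennreal_ofReal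
    (Filter.Eventually.of_forall fun _ => ENNReal.ofReal_lt_top)] at h1
  set C : SL(2, ℝ) → ℝ := fun g => g 0 0 ^ 2 + g 0 1 ^ 2 + g 1 0 ^ 2 + g 1 1 ^ 2 with hC
  have hmult : ∀ (g : SL(2, ℝ)) (x : ℝ), multF g x ^ 2 ≤ C g ^ 2 * (kF g x ^ 2)⁻¹ := by
    intro g x
    have hb := kF_inv_sq_le g x
    have hp : 0 < (kF g x ^ 2)⁻¹ := inv_pos.2 (pow_pos (kF_pos _ _) 2)
    have e : multF g x ^ 2 = ((kF g x ^ 2)⁻¹) ^ 2 * (kF g x ^ 2)⁻¹ * sF g x ^ 2 := by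
      unfold multF; rw [← inv_pow, ← inv_pow]; ring
    rw [e]
    calc ((kF g x ^ 2)⁻¹) ^ 2 * (kF g x ^ 2)⁻¹ * sF g x ^ 2
        ≤ ((kF g x ^ 2)⁻¹) ^ 2 * (kF g x ^ 2)⁻¹ * 1 := by
          gcongr; exact sF_sq_le g x
      _ ≤ C g ^ 2 * (kF g x ^ 2)⁻¹ := by
          rw [mul_one]; gcongr
  refine (h1.const_mul (C g.1 ^ 2 * C g.2 ^ 2)).mono' (hmeas.pow 2)
    (Filter.Eventually.of_forall fun z => ?_)
  rw [Real.norm_of_nonneg (sq_nonneg _), ENNReal.toReal_ofReal (dens_pos g z).le]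
  calc dualFun g φ z ^ 2 = (multF g.1 z.1 ^ 2 * multF g.2 z.2 ^ 2) * (φ (mobPair g z)) ^ 2 := by
        simp only [dualFun, mobPair, Prod.map]; ring
    _ ≤ ((C g.1 ^ 2 * (kF g.1 z.1 ^ 2)⁻¹) * (C g.2 ^ 2 * (kF g.2 z.2 ^ 2)⁻¹)) *
        (φ (mobPair g z)) ^ 2 := by
          gcongr
          · exact hmult _ _
          · exact hmult _ _
    _ = _ := by simp only [dens, Function.comp]; ring

/-- The Hilbert space `L²(𝒫, λ, ℝ)`, identified with its topological dual. -/
abbrev L2Torus : Type := Lp ℝ 2 torusMeasure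

/-- The dual action `(T'(g,h)φ)(x,y) = k_g(x)⁻³ s_g(x) k_h(y)⁻³ s_h(y) φ(xg, yh)` of `𝒢` on
`L²(𝒫, λ, ℝ)`. The little group of `φ` is its stabilizer. -/
instance dualAction : MulAction SLxSL L2Torus where
  smul g φ := (memLp_dualFun g (Lp.memLp φ)).toLp (dualFun g φ)
  one_smul φ := by
    apply Lp.ext
    refine (MemLp.coeFn_toLp (memLp_dualFun 1 (Lp.memLp φ))).trans
      (Filter.Eventually.of_forall fun z => ?_)
    simp [dualFun, multF_one, mob_one]
  mul_smul g h φ := by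
    apply Lp.ext
    refine (MemLp.coeFn_toLp (memLp_dualFun (g * h) (Lp.memLp φ))).trans ?_
    refine Filter.EventuallyEq.trans ?_
      (MemLp.coeFn_toLp (memLp_dualFun g (Lp.memLp
        ((memLp_dualFun h (Lp.memLp φ)).toLp (dualFun h φ))))).symm
    have h1 := (quasi_mobPair g).ae_eq (MemLp.coeFn_toLp (memLp_dualFun h (Lp.memLp φ)))
    filter_upwards [h1, ae_torus_denF g] with z hz hd
    have hz' : (((memLp_dualFun h (Lp.memLp φ)).toLp (dualFun h φ) : Lp ℝ 2 torusMeasure) :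
        ℝ × ℝ → ℝ) (mob g.1 z.1, mob g.2 z.2) = dualFun h φ (mob g.1 z.1, mob g.2 z.2) := hz
    rw [dualFun, dualFun, hz', dualFun, Prod.fst_mul, Prod.snd_mul, multF_mul _ _ _ hd.1,
      multF_mul _ _ _ hd.2, mob_mul _ _ _ hd.1, mob_mul _ _ _ hd.2]
    ring

end

/-! The argument rests on two facts: `H` is a compact abelian group of rotations, and the orbit map
of a non-zero vector under the dual action is proper.

The logarithmic derivative of `det exp(tX)` is `tr X`, so the Lie algebra of `𝒢` consists of the
pairs of trace-zero matrices. Conjugation by a rotation turns the plane of `A₁, A₂` through twice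
the angle and fixes `A₃`; commutativity of `H` makes `Ad_H` trivial. The measure `ν` is the image of
Haar measure under the homomorphism `(i, θ) ↦ ε_i(θ)` from `ℤ/N × ℝ/2πℤ` onto `H`, which need not be
injective.

The invariant measure `m` is the image of `μ` on the coset space. Weil's formula is then Fubini
together with right invariance of `μ` under rotations. For uniqueness, an invariant `m'` is lifted
by averaging and the Riesz theorem to a left invariant measure on `𝒢`, a multiple of `μ`, and tested
on functions pulled back from the quotient.

For the topology, `iwasawa` identifies `𝒢` with `ℝ⁴ × T²`, where right rotations move only the
torus. There `H` is the kernel of the single character `w^(N'q) z^(-N'p)`, `N' = N / gcd(N, q)`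
(`torusChar_eq_one_iff`), and the image of this character is `S¹`. An orbit is the same quotient of
`𝒢` provided its norm topology is the quotient topology. A change of variables writes `‖gφ‖²` as the
integral of `φ²` against a weight that grows with `g` off a thin set (`exists_le_norm_smul_L2`), so
the orbit map is proper, hence closed (`isProperMap_smul_L2`). -/

noncomputable section

/-! ### The Lie algebra of `𝒢` and the adjoint representation -/

section LieAlgebra

attribute [local instance] Matrix.linftyOpNormedRing Matrix.linftyOpNormedAlgebra

lemma hasDerivAt_exp_smul_matrix (X : Matrix (Fin 2) (Fin 2) ℝ) (t : ℝ) :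
    HasDerivAt (fun u : ℝ => NormedSpace.exp (u • X)) (NormedSpace.exp (t • X) * X) t :=
  hasDerivAt_exp_smul_const X t

/-- Passing to entries leaves real-valued functions, so the auxiliary matrix norm disappears from
everything that follows. -/
lemma hasDerivAt_exp_smul_apply (X : Matrix (Fin 2) (Fin 2) ℝ) (t : ℝ) (i j : Fin 2) :
    HasDerivAt (fun u : ℝ => NormedSpace.exp (u • X) i j) ((NormedSpace.exp (t • X) * X) i j) t := by
  let ev : Matrix (Fin 2) (Fin 2) ℝ →L[ℝ] ℝ :=
    LinearMap.toContinuousLinearMap (Matrix.entryLinearMap ℝ ℝ i j)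
  exact ev.hasFDerivAt.comp_hasDerivAt t (hasDerivAt_exp_smul_matrix X t)

end LieAlgebra

/-- Jacobi's formula, by direct expansion of the `2 × 2` determinant. -/
lemma hasDerivAt_det_exp_smul (X : Matrix (Fin 2) (Fin 2) ℝ) (t : ℝ) :
    HasDerivAt (fun u : ℝ => (NormedSpace.exp (u • X)).det)
      (X.trace * (NormedSpace.exp (t • X)).det) t := by
  simp only [Matrix.det_fin_two]
  refine (((hasDerivAt_exp_smul_apply X t 0 0).mul (hasDerivAt_exp_smul_apply X t 1 1)).sub
    ((hasDerivAt_exp_smul_apply X t 0 1).mul (hasDerivAt_exp_smul_apply X t 1 0))).congr_deriv ?_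
  simp only [Matrix.mul_apply, Fin.sum_univ_two, Matrix.trace_fin_two]
  ring

lemma det_exp_smul_of_trace_eq_zero {X : Matrix (Fin 2) (Fin 2) ℝ} (hX : X.trace = 0) (t : ℝ) :
    (NormedSpace.exp (t • X)).det = 1 := by
  have h := is_const_of_deriv_eq_zero (f := fun u : ℝ => (NormedSpace.exp (u • X)).det)
    (fun u => (hasDerivAt_det_exp_smul X u).differentiableAt)
    (fun u => by rw [(hasDerivAt_det_exp_smul X u).deriv, hX, zero_mul]) t 0
  simpa using h

lemma trace_eq_zero_of_det_exp_smul {X : Matrix (Fin 2) (Fin 2) ℝ}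
    (hX : ∀ t : ℝ, (NormedSpace.exp (t • X)).det = 1) : X.trace = 0 := by
  have h := hasDerivAt_det_exp_smul X 0
  simp only [hX, mul_one] at h
  exact h.unique (hasDerivAt_const 0 1)

/-- A one-parameter group determines its generator as its derivative at `0`. -/
lemma eq_of_exp_smul_eq {X Y : Matrix (Fin 2) (Fin 2) ℝ}
    (h : ∀ t : ℝ, NormedSpace.exp (t • X) = NormedSpace.exp (t • Y)) : X = Y := by
  ext i j
  have h1 := hasDerivAt_exp_smul_apply X 0 i j
  have h2 := hasDerivAt_exp_smul_apply Y 0 i j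
  simp only [h, zero_smul, NormedSpace.exp_zero, one_mul] at h1 h2
  exact h1.unique h2

lemma mem_expSet_top {X : MatPair} (h1 : X.1.trace = 0) (h2 : X.2.trace = 0) :
    X ∈ expSet ⊤ := fun t =>
  ⟨(⟨_, det_exp_smul_of_trace_eq_zero h1 t⟩, ⟨_, det_exp_smul_of_trace_eq_zero h2 t⟩),
    Subgroup.mem_top _, rfl, rfl⟩

lemma mem_lieAlg_top {X : MatPair} : X ∈ lieAlg ⊤ ↔ X.1.trace = 0 ∧ X.2.trace = 0 := by
  refine ⟨fun hX => ?_, fun h => Submodule.subset_span (mem_expSet_top h.1 h.2)⟩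
  let T : MatPair →ₗ[ℝ] ℝ × ℝ :=
    (Matrix.traceLinearMap (Fin 2) ℝ ℝ).prodMap (Matrix.traceLinearMap (Fin 2) ℝ ℝ)
  -- Since `lieAlg` is a span, the trace condition is packaged as the kernel of a linear map and
  -- needs checking only on `expSet`.
  have hle : lieAlg ⊤ ≤ LinearMap.ker T := by
    refine Submodule.span_le.2 fun Y hY => ?_
    have e1 : Y.1.trace = 0 := trace_eq_zero_of_det_exp_smul fun t => by
      obtain ⟨s, -, h, -⟩ := hY t
      rw [h]; exact s.1.2
    have e2 : Y.2.trace = 0 := trace_eq_zero_of_det_exp_smul fun t => by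
      obtain ⟨s, -, -, h⟩ := hY t
      rw [h]; exact s.2.2
    exact LinearMap.mem_ker.2 (Prod.ext e1 e2)
  have := LinearMap.mem_ker.1 (hle hX)
  exact ⟨congrArg Prod.fst this, congrArg Prod.snd this⟩

lemma trace_basisSl2 (i : Fin 3) : (basisSl2 i).trace = 0 := by
  fin_cases i <;> simp [basisSl2, Matrix.trace_fin_two]

lemma generator_mem (j : Fin 3 ⊕ Fin 3) : generator j ∈ lieAlg ⊤ := by
  rcases j with j | j <;> simp [mem_lieAlg_top, generator, trace_basisSl2]

lemma sum_smul_basisSl2 (c : Fin 3 → ℝ) :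
    ∑ i, c i • basisSl2 i = !![c 1, c 0 + c 2; c 0 - c 2, -c 1] := by
  ext i j
  fin_cases i <;> fin_cases j <;>
    (simp [Fin.sum_univ_three, basisSl2]; try ring)

lemma sum_smul_basisSl2_eq_zero {c : Fin 3 → ℝ} (h : ∑ i, c i • basisSl2 i = 0) : c = 0 := by
  rw [sum_smul_basisSl2] at h
  have h0 := congrFun (congrFun h 0) 0
  have h1 := congrFun (congrFun h 0) 1
  have h2 := congrFun (congrFun h 1) 0
  simp at h0 h1 h2
  ext i
  fin_cases i <;> (simp; linarith)

lemma eq_sum_smul_basisSl2 {X : Matrix (Fin 2) (Fin 2) ℝ} (hX : X.trace = 0) :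
    X = ∑ i, (![(X 0 1 + X 1 0) / 2, X 0 0, (X 0 1 - X 1 0) / 2] : Fin 3 → ℝ) i • basisSl2 i := by
  rw [Matrix.trace_fin_two] at hX
  rw [sum_smul_basisSl2]
  ext i j
  fin_cases i <;> fin_cases j <;> simp <;> linarith

lemma sum_smul_generator (c : Fin 3 ⊕ Fin 3 → ℝ) :
    ∑ j, c j • generator j =
      (∑ i, c (Sum.inl i) • basisSl2 i, ∑ i, c (Sum.inr i) • basisSl2 i) := by
  simp [Fintype.sum_sum_type, generator, Prod.ext_iff, Prod.fst_sum, Prod.snd_sum]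

/-- The generators `Ω₁, …, Ω₆` as elements of the Lie algebra of `𝒢`. -/
def lieGenerator (j : Fin 3 ⊕ Fin 3) : lieAlg ⊤ := ⟨generator j, generator_mem j⟩

lemma linearIndependent_lieGenerator : LinearIndependent ℝ lieGenerator := by
  rw [Fintype.linearIndependent_iff]
  intro c hc
  have h : ∑ j, c j • generator j = 0 := by
    have := congrArg (Subtype.val : lieAlg ⊤ → MatPair) hc
    simpa [lieGenerator] using this
  rw [sum_smul_generator] at h
  have h1 := sum_smul_basisSl2_eq_zero (c := fun i => c (Sum.inl i)) (congrArg Prod.fst h)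
  have h2 := sum_smul_basisSl2_eq_zero (c := fun i => c (Sum.inr i)) (congrArg Prod.snd h)
  rintro (j | j)
  · exact congrFun h1 j
  · exact congrFun h2 j

lemma top_le_span_lieGenerator : ⊤ ≤ Submodule.span ℝ (Set.range lieGenerator) := by
  rintro ⟨X, hX⟩ -
  obtain ⟨h1, h2⟩ := mem_lieAlg_top.1 hX
  rw [Submodule.mem_span_range_iff_exists_fun]
  refine ⟨Sum.elim ![(X.1 0 1 + X.1 1 0) / 2, X.1 0 0, (X.1 0 1 - X.1 1 0) / 2]
    ![(X.2 0 1 + X.2 1 0) / 2, X.2 0 0, (X.2 0 1 - X.2 1 0) / 2], ?_⟩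
  apply Subtype.ext
  have e := sum_smul_generator (Sum.elim ![(X.1 0 1 + X.1 1 0) / 2, X.1 0 0, (X.1 0 1 - X.1 1 0) / 2]
    ![(X.2 0 1 + X.2 1 0) / 2, X.2 0 0, (X.2 0 1 - X.2 1 0) / 2])
  simp only [Sum.elim_inl, Sum.elim_inr] at e
  rw [← eq_sum_smul_basisSl2 h1, ← eq_sum_smul_basisSl2 h2] at e
  simpa [lieGenerator] using e

/-- The basis `Ω₁, …, Ω₆` of the Lie algebra of `𝒢`. -/
def lieBasis : Module.Basis (Fin 3 ⊕ Fin 3) ℝ (lieAlg ⊤) :=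
  Module.Basis.mk linearIndependent_lieGenerator top_le_span_lieGenerator

lemma coe_lieBasis (j : Fin 3 ⊕ Fin 3) : (lieBasis j : MatPair) = generator j := by
  rw [lieBasis, Module.Basis.mk_apply, lieGenerator]

/-- These are the double angle formulas: rotations commute with `A₃` and rotate the symmetric
trace-zero matrices by `2θ`. -/
lemma rot_conj_basisSl2 (θ : ℝ) (j : Fin 3) :
    (rot θ : Matrix (Fin 2) (Fin 2) ℝ) * basisSl2 j * ((rot θ)⁻¹ : SL(2, ℝ)) =
      ∑ k, adBlock θ j k • basisSl2 k := by
  have h := Real.sin_sq_add_cos_sq θ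
  rw [sum_smul_basisSl2, ← rot_neg]
  ext a b
  fin_cases j <;> fin_cases a <;> fin_cases b <;>
    simp [adBlock, basisSl2, rot, Matrix.mul_apply, Fin.sum_univ_two, Real.sin_two_mul,
      Real.cos_two_mul'] <;> linarith

/-- The transpose reconciles two conventions: the image of a basis vector is a row of `M`, but a
column of `LinearMap.toMatrix`. -/
lemma toMatrix_AdG_rot (α β : ℝ) :
    LinearMap.toMatrix lieBasis lieBasis (AdG (rot α, rot β)) =
      (Matrix.fromBlocks (adBlock α) 0 0 (adBlock β)).transpose := by
  rw [← LinearEquiv.eq_symm_apply, LinearMap.toMatrix_symm]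
  refine lieBasis.ext fun j => ?_
  rw [Matrix.toLin_self]
  apply Subtype.ext
  have e := sum_smul_generator fun i => (Matrix.fromBlocks (adBlock α) 0 0 (adBlock β)) j i
  have e' : (AdG (rot α, rot β) (lieBasis j) : MatPair) = conjPair (rot α, rot β) (generator j) := by
    rw [← coe_lieBasis]; rfl
  rw [e']
  simp only [Submodule.coe_sum, Submodule.coe_smul, coe_lieBasis, Matrix.transpose_apply]
  rw [e]
  rcases j with j | j
  · simpa [conjPair, generator] using rot_conj_basisSl2 α j
  · simpa [conjPair, generator] using rot_conj_basisSl2 β j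

lemma det_adBlock (α : ℝ) : (adBlock α).det = 1 := by
  rw [Matrix.det_fin_three]
  simp [adBlock]
  nlinarith [Real.sin_sq_add_cos_sq (2 * α)]

lemma det_AdG_rot (α β : ℝ) : LinearMap.det (AdG (rot α, rot β)) = 1 := by
  rw [← LinearMap.det_toMatrix lieBasis, toMatrix_AdG_rot, Matrix.det_transpose,
    Matrix.det_fromBlocks_zero₂₁, det_adBlock, det_adBlock, one_mul]

lemma littleGroup_mul_comm {N : ℕ} {q p : ℤ} {g h : SLxSL} (hg : g ∈ littleGroup N q p)
    (hh : h ∈ littleGroup N q p) : g * h = h * g := by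
  obtain ⟨i, θ, rfl⟩ := hg
  obtain ⟨j, η, rfl⟩ := hh
  rw [← littleElt_add, ← littleElt_add, add_comm i, add_comm θ]

/-- Conjugation by `g` fixes every `exp(tY)` lying in `S`, hence fixes `Y`; the fixed vectors form a
subspace, which takes care of the span. -/
lemma conjPair_of_commute {S : Subgroup SLxSL} {g : SLxSL} (hg : ∀ s ∈ S, g * s = s * g)
    {X : MatPair} (hX : X ∈ lieAlg S) : conjPair g X = X := by
  have hle : lieAlg S ≤ LinearMap.eqLocus (conjPair g) LinearMap.id := by
    refine Submodule.span_le.2 fun Y hY => ?_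
    have hc : ∀ a b : SL(2, ℝ), a * b = b * a →
        (a : Matrix (Fin 2) (Fin 2) ℝ) * b * (a⁻¹ : SL(2, ℝ)) = b := fun a b hab => by
      rw [← Matrix.SpecialLinearGroup.coe_mul, hab, ← Matrix.SpecialLinearGroup.coe_mul,
        mul_inv_cancel_right]
    refine Prod.ext (eq_of_exp_smul_eq fun t => ?_) (eq_of_exp_smul_eq fun t => ?_)
    · obtain ⟨s, hs, h, -⟩ := hY t
      change NormedSpace.exp (t • ((g.1 : Matrix (Fin 2) (Fin 2) ℝ) * Y.1 *
        (g.1⁻¹ : SL(2, ℝ)))) = NormedSpace.exp (t • Y.1)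
      rw [← Matrix.smul_mul, ← Matrix.mul_smul, exp_conj_SL, h,
        hc _ _ (congrArg Prod.fst (hg s hs))]
    · obtain ⟨s, hs, -, h⟩ := hY t
      change NormedSpace.exp (t • ((g.2 : Matrix (Fin 2) (Fin 2) ℝ) * Y.2 *
        (g.2⁻¹ : SL(2, ℝ)))) = NormedSpace.exp (t • Y.2)
      rw [← Matrix.smul_mul, ← Matrix.mul_smul, exp_conj_SL, h,
        hc _ _ (congrArg Prod.snd (hg s hs))]
  exact hle hX

lemma AdRep_littleGroup (N : ℕ) (q p : ℤ) (h : littleGroup N q p) :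
    AdRep (littleGroup N q p) h = LinearMap.id :=
  LinearMap.ext fun X => Subtype.ext
    (conjPair_of_commute (fun _ hs => littleGroup_mul_comm h.2 hs) X.2)

/-! ### The Haar measure of `H(N,q,p)` -/

lemma continuous_rot : Continuous rot := by
  refine Continuous.subtype_mk (continuous_matrix fun i j => ?_) _
  fin_cases i <;> fin_cases j <;> simp <;> fun_prop

lemma rot_add_int_mul_two_pi (a : ℝ) (k : ℤ) : rot (a + k * (2 * Real.pi)) = rot a := by
  apply Subtype.ext
  ext i j
  fin_cases i <;> fin_cases j <;>
    simp [rot, Real.cos_add_int_mul_two_pi, Real.sin_add_int_mul_two_pi]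

section

variable (N : ℕ) (q p : ℤ)

lemma continuous_littleMk (i : ℤ) : Continuous (littleMk N q p i) := by
  refine Continuous.subtype_mk ?_ _
  unfold littleElt
  exact (continuous_rot.comp (by fun_prop)).prodMk (continuous_rot.comp (by fun_prop))

lemma littleMk_add (i j : ℤ) (θ η : ℝ) :
    littleMk N q p (i + j) (θ + η) = littleMk N q p i θ * littleMk N q p j η :=
  Subtype.ext (littleElt_add N q p i j θ η)

lemma littleMk_add_two_pi (i : ℤ) (θ : ℝ) :
    littleMk N q p i (θ + 2 * Real.pi) = littleMk N q p i θ := by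
  apply Subtype.ext
  refine Prod.ext ?_ ?_
  · change rot (q * (θ + 2 * Real.pi)) = rot (q * θ)
    rw [mul_add, rot_add_int_mul_two_pi]
  · change rot (p * (θ + 2 * Real.pi) + 2 * Real.pi / N * i) = rot (p * θ + 2 * Real.pi / N * i)
    rw [mul_add, add_right_comm, rot_add_int_mul_two_pi]

lemma littleMk_add_natCast [NeZero N] (i : ℤ) (θ : ℝ) :
    littleMk N q p (i + N) θ = littleMk N q p i θ := by
  have hN : (N : ℝ) ≠ 0 := NeZero.ne _
  apply Subtype.ext
  refine Prod.ext (show rot (q * θ) = rot (q * θ) from rfl) ?_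
  change rot (p * θ + 2 * Real.pi / N * ((i + N : ℤ) : ℝ)) = rot (p * θ + 2 * Real.pi / N * i)
  rw [← rot_add_int_mul_two_pi (p * θ + 2 * Real.pi / N * i) 1]
  congr 1
  push_cast
  field_simp
  ring

/-- The index is reduced modulo `N` and the angle modulo `2π`. Such a pair need not be unique, but
compactness of `H` needs only existence. -/
lemma exists_littleMk [NeZero N] (h : littleGroup N q p) :
    ∃ (i : Fin N) (θ : ℝ), θ ∈ Set.Icc 0 (2 * Real.pi) ∧ h = littleMk N q p ((i : ℕ) : ℤ) θ := by
  obtain ⟨h, i, θ, rfl⟩ := h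
  have hN : (0 : ℤ) < N := by exact_mod_cast Nat.pos_of_ne_zero (NeZero.ne N)
  have hi : Function.Periodic (fun i => littleMk N q p i) (N : ℤ) := fun i =>
    funext fun θ => littleMk_add_natCast N q p i θ
  have hθ : ∀ i, Function.Periodic (littleMk N q p i) (2 * Real.pi) := fun i =>
    littleMk_add_two_pi N q p i
  obtain ⟨η, hη, e⟩ := (hθ i).exists_mem_Ico₀ Real.two_pi_pos θ
  have h0 := Int.emod_nonneg i hN.ne'
  have h1 := Int.emod_lt_of_pos i hN
  refine ⟨⟨(i % N).toNat, by omega⟩, η, ⟨hη.1, hη.2.le⟩, ?_⟩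
  change littleMk N q p i θ = _
  rw [e]
  simp only [Int.toNat_of_nonneg h0]
  have h2 := (hi.int_mul (i / N)) (i % N)
  have h3 : i % N + (i / N) * N = i := by rw [mul_comm]; exact Int.emod_add_mul_ediv i N
  rw [← congrFun h2 η]
  simp only [Int.cast_id, h3]

lemma compactSpace_littleGroup [NeZero N] : CompactSpace (littleGroup N q p) := by
  refine ⟨?_⟩
  have : (Set.univ : Set (littleGroup N q p)) =
      ⋃ i : Fin N, littleMk N q p ((i : ℕ) : ℤ) '' Set.Icc 0 (2 * Real.pi) := by
    ext h
    obtain ⟨i, θ, hθ, e⟩ := exists_littleMk N q p h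
    simp only [Set.mem_univ, Set.mem_iUnion, true_iff]
    exact ⟨i, θ, hθ, e.symm⟩
  rw [this]
  exact isCompact_iUnion fun i => isCompact_Icc.image (continuous_littleMk N q p _)

lemma lintegral_littleMeasure {f : littleGroup N q p → ℝ≥0∞} (hf : Measurable f) :
    ∫⁻ h, f h ∂(littleMeasure N q p) = (N : ℝ≥0∞)⁻¹ * ∑ i : Fin N,
      ((ENNReal.ofReal (2 * Real.pi))⁻¹ *
        ∫⁻ θ in Set.Ioc (0 : ℝ) (2 * Real.pi), f (littleMk N q p ((i : ℕ) : ℤ) θ)) := by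
  simp only [littleMeasure, lintegral_smul_measure, smul_eq_mul, lintegral_finsetSum_measure]
  congr 1
  refine Finset.sum_congr rfl fun i _ => ?_
  rw [lintegral_map hf (continuous_littleMk N q p _).measurable]

lemma isProbabilityMeasure_littleMeasure [NeZero N] :
    IsProbabilityMeasure (littleMeasure N q p) := by
  have h2 : ENNReal.ofReal (2 * Real.pi) ≠ 0 := by simpa using Real.pi_pos
  refine ⟨?_⟩
  have h := lintegral_littleMeasure N q p (f := fun _ => 1) measurable_const
  simp only [lintegral_const, one_mul, Measure.restrict_apply MeasurableSet.univ, Set.univ_inter,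
    Real.volume_Ioc, sub_zero, ENNReal.inv_mul_cancel h2 ENNReal.ofReal_ne_top] at h
  rw [h]
  simp only [Finset.sum_const, Finset.card_univ, Fintype.card_fin, nsmul_eq_mul, mul_one]
  exact ENNReal.inv_mul_cancel (by simpa using NeZero.ne N) (ENNReal.natCast_ne_top N)

/-- Translation carries `(0, T]` to `(a, a + T]`, and both are fundamental domains for `ℤT`. -/
lemma setLIntegral_Ioc_add_of_periodic {F : ℝ → ℝ≥0∞} {T : ℝ} (hT : 0 < T)
    (hF : Function.Periodic F T) (a : ℝ) :
    ∫⁻ θ in Set.Ioc 0 T, F (a + θ) = ∫⁻ θ in Set.Ioc 0 T, F θ := by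
  have h1 : ∫⁻ θ in Set.Ioc 0 T, F (a + θ) = ∫⁻ θ in Set.Ioc a (a + T), F θ := by
    have := (measurePreserving_add_left volume a).setLIntegral_comp_preimage_emb
      (measurableEmbedding_addLeft a) F (Set.Ioc a (a + T))
    rw [← this]
    congr 2
    ext x; simp
  rw [h1]
  have h2 := (isAddFundamentalDomain_Ioc hT 0).setLIntegral_eq (isAddFundamentalDomain_Ioc hT a) F
    (fun g x => by
      obtain ⟨n, hn⟩ := AddSubgroup.mem_zmultiples_iff.1 g.2
      change F (g + x) = F x
      rw [← hn, add_comm, hF.zsmul n])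
  rw [zero_add] at h2
  exact h2.symm

lemma sum_fin_add_of_periodic [NeZero N] {M : Type*} [AddCommMonoid M] {F : ℤ → M}
    (hF : Function.Periodic F N) (j : ℤ) :
    ∑ i : Fin N, F (j + ((i : ℕ) : ℤ)) = ∑ i : Fin N, F ((i : ℕ) : ℤ) := by
  have step : ∀ j : ℤ, ∑ i : Fin N, F (j + 1 + ((i : ℕ) : ℤ)) =
      ∑ i : Fin N, F (j + ((i : ℕ) : ℤ)) := by
    intro j
    obtain ⟨n, rfl⟩ : ∃ n, N = n + 1 := Nat.exists_eq_succ_of_ne_zero (NeZero.ne N)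
    -- The last term of the shifted sum is matched with the first term of the original one by
    -- periodicity; the other terms agree one by one.
    rw [Fin.sum_univ_castSucc, Fin.sum_univ_succ, add_comm (∑ i : Fin n, _)]
    refine congrArg₂ _ ?_ ?_
    · refine (congrArg F ?_).trans ((hF j).trans (congrArg F ?_))
      · simp
        ring
      · simp
    · refine Finset.sum_congr rfl fun i _ => congrArg F ?_
      simp
      ring
  induction j using Int.induction_on with
  | zero => simp
  | succ k ih => rw [step, ih]
  | pred k ih => rw [← ih, ← step, sub_add_cancel]

/-- Left translation by `ε_j(η)` shifts the parameters to `(j + i, η + θ)`. Both shifts are absorbed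
by periodicity, so injectivity of the parametrisation plays no role. -/
lemma isMulLeftInvariant_littleMeasure [NeZero N] :
    (littleMeasure N q p).IsMulLeftInvariant := by
  refine ⟨fun h => Measure.ext_of_lintegral _ fun f hf => ?_⟩
  obtain ⟨h, j, η, rfl⟩ := h
  change ∫⁻ a, f a ∂(Measure.map (fun x => littleMk N q p j η * x) (littleMeasure N q p)) = _
  have hm : Measurable (fun x => littleMk N q p j η * x) := (continuous_const_mul _).measurable
  rw [lintegral_map hf hm, lintegral_littleMeasure N q p hf,
    lintegral_littleMeasure N q p (f := fun a => f (littleMk N q p j η * a)) (hf.comp hm)]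
  congr 1
  simp only [← littleMk_add]
  have e : ∀ i : ℤ, ∫⁻ θ in Set.Ioc (0 : ℝ) (2 * Real.pi), f (littleMk N q p (j + i) (η + θ)) =
      ∫⁻ θ in Set.Ioc (0 : ℝ) (2 * Real.pi), f (littleMk N q p (j + i) θ) := fun i =>
    setLIntegral_Ioc_add_of_periodic Real.two_pi_pos
      (F := fun θ => f (littleMk N q p (j + i) θ))
      (fun θ => by simp only [littleMk_add_two_pi]) η
  simp only [e]
  exact sum_fin_add_of_periodic N (F := fun i => (ENNReal.ofReal (2 * Real.pi))⁻¹ *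
    ∫⁻ θ in Set.Ioc (0 : ℝ) (2 * Real.pi), f (littleMk N q p i θ))
    (fun i => by simp only [littleMk_add_natCast]) j

lemma isHaarMeasure_littleMeasure [NeZero N] : (littleMeasure N q p).IsHaarMeasure := by
  have := compactSpace_littleGroup N q p
  have := isProbabilityMeasure_littleMeasure N q p
  have := isMulLeftInvariant_littleMeasure N q p
  have : (littleMeasure N q p).IsOpenPosMeasure :=
    isOpenPosMeasure_of_mulLeftInvariant_of_compact Set.univ isCompact_univ (by simp)
  exact {}

end

/-! ### The homeomorphism type of the coset space -/

/-- The rotation with `cos θ + i sin θ` a given point of the circle. -/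
def circleRot (z : Circle) : SL(2, ℝ) :=
  ⟨!![(z : ℂ).re, (z : ℂ).im; -(z : ℂ).im, (z : ℂ).re], by
    have h := Circle.normSq_coe z
    rw [Complex.normSq_apply] at h
    rw [Matrix.det_fin_two_of]; linarith⟩

lemma circleRot_mul (z w : Circle) : circleRot (z * w) = circleRot z * circleRot w := by
  apply Subtype.ext
  rw [Matrix.SpecialLinearGroup.coe_mul]
  ext i j
  fin_cases i <;> fin_cases j <;> simp [circleRot, Matrix.mul_apply, Fin.sum_univ_two] <;> ring

lemma circleRot_exp (θ : ℝ) : circleRot (Circle.exp θ) = rot θ := by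
  apply Subtype.ext
  ext i j
  fin_cases i <;> fin_cases j <;>
    simp [circleRot, rot, Circle.coe_exp, Complex.exp_ofReal_mul_I_re, Complex.exp_ofReal_mul_I_im]

/-- The upper triangular matrix with diagonal `e⁻ˢ, eˢ` and off-diagonal entry `u`. -/
def upperTri (x : ℝ × ℝ) : SL(2, ℝ) :=
  ⟨!![Real.exp (-x.1), x.2; 0, Real.exp x.1], by
    rw [Matrix.det_fin_two_of, ← Real.exp_add]; simp⟩

lemma sq_add_sq_bottom_pos (g : SL(2, ℝ)) : 0 < g 1 0 ^ 2 + g 1 1 ^ 2 := by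
  have h := det_SL g
  by_contra hc
  have h1 : g 1 0 = 0 := by nlinarith [sq_nonneg (g 1 0), sq_nonneg (g 1 1)]
  have h2 : g 1 1 = 0 := by nlinarith [sq_nonneg (g 1 0), sq_nonneg (g 1 1)]
  simp [h1, h2] at h

/-- The norm of the bottom row. -/
def bottomNorm (g : SL(2, ℝ)) : ℝ := Real.sqrt (g 1 0 ^ 2 + g 1 1 ^ 2)

lemma bottomNorm_pos (g : SL(2, ℝ)) : 0 < bottomNorm g := Real.sqrt_pos.2 (sq_add_sq_bottom_pos g)

lemma bottomNorm_sq (g : SL(2, ℝ)) : bottomNorm g ^ 2 = g 1 0 ^ 2 + g 1 1 ^ 2 :=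
  Real.sq_sqrt (sq_add_sq_bottom_pos g).le

/-- The rotation part of the Iwasawa decomposition. -/
def iwasawaCircle (g : SL(2, ℝ)) : Circle :=
  ⟨⟨g 1 1 / bottomNorm g, -g 1 0 / bottomNorm g⟩, by
    rw [show _ ∈ Submonoid.unitSphere ℂ ↔ _ from mem_sphere_zero_iff_norm, ← sq_eq_sq₀ (norm_nonneg _) zero_le_one, Complex.sq_norm,
      Complex.normSq_apply]
    have := (bottomNorm_pos g).ne'
    have := bottomNorm_sq g
    field_simp
    linarith⟩

lemma continuous_entry (i j : Fin 2) : Continuous (fun g : SL(2, ℝ) => g i j) :=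
  (continuous_apply_apply i j).comp continuous_subtype_val

lemma continuous_bottomNorm : Continuous bottomNorm :=
  (((continuous_entry 1 0).pow 2).add ((continuous_entry 1 1).pow 2)).sqrt

/-- The Iwasawa decomposition `SL(2,ℝ) = B · SO(2)` as a homeomorphism. -/
def iwasawa : SL(2, ℝ) ≃ₜ (ℝ × ℝ) × Circle where
  -- In `upperTri (s, u) * rot θ` the bottom row is `eˢ(-sin θ, cos θ)` and the inner product of the
  -- two rows is `u eˢ`, which gives `s`, `θ` and `u`.
  toFun g := ((Real.log (bottomNorm g), (g 0 0 * g 1 0 + g 0 1 * g 1 1) / bottomNorm g),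
    iwasawaCircle g)
  invFun x := upperTri x.1 * circleRot x.2
  left_inv g := by
    have h0 := bottomNorm_pos g
    have h1 := bottomNorm_sq g
    have h2 := det_SL g
    apply Subtype.ext
    rw [Matrix.SpecialLinearGroup.coe_mul]
    ext i j
    fin_cases i <;> fin_cases j <;>
      simp [upperTri, circleRot, iwasawaCircle, Matrix.mul_apply, Fin.sum_univ_two, Real.exp_neg,
        Real.exp_log h0] <;> field_simp <;> try rw [h1]
    · linear_combination (-g 1 1) * h2
    · linear_combination (g 1 0) * h2
  right_inv := by
    rintro ⟨⟨s, u⟩, z⟩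
    have hz := Circle.normSq_coe z
    rw [Complex.normSq_apply] at hz
    have hs := Real.exp_pos s
    have e00 : (upperTri (s, u) * circleRot z) 0 0 = Real.exp (-s) * (z : ℂ).re - u * (z : ℂ).im := by
      rw [Matrix.SpecialLinearGroup.coe_mul]
      simp [upperTri, circleRot, Matrix.mul_apply, Fin.sum_univ_two, sub_eq_add_neg]
    have e01 : (upperTri (s, u) * circleRot z) 0 1 = Real.exp (-s) * (z : ℂ).im + u * (z : ℂ).re := by
      rw [Matrix.SpecialLinearGroup.coe_mul]
      simp [upperTri, circleRot, Matrix.mul_apply, Fin.sum_univ_two]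
    have e10 : (upperTri (s, u) * circleRot z) 1 0 = -(Real.exp s * (z : ℂ).im) := by
      rw [Matrix.SpecialLinearGroup.coe_mul]
      simp [upperTri, circleRot, Matrix.mul_apply, Fin.sum_univ_two]
    have e11 : (upperTri (s, u) * circleRot z) 1 1 = Real.exp s * (z : ℂ).re := by
      rw [Matrix.SpecialLinearGroup.coe_mul]
      simp [upperTri, circleRot, Matrix.mul_apply, Fin.sum_univ_two]
    have hb : bottomNorm (upperTri (s, u) * circleRot z) = Real.exp s := by
      rw [bottomNorm, e10, e11, Real.sqrt_eq_iff_mul_self_eq_of_pos hs]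
      linear_combination (-Real.exp s ^ 2) * hz
    refine Prod.ext (Prod.ext ?_ ?_) ?_
    · simp only [hb, Real.log_exp]
    · simp only [hb, e00, e01, e10, e11]
      field_simp
      linear_combination u * hz
    · apply Circle.ext
      apply Complex.ext
      · simp only [iwasawaCircle, hb, e11]
        field_simp
      · simp only [iwasawaCircle, hb, e10]
        field_simp
  continuous_toFun := by
    have hb := continuous_bottomNorm
    have hne : ∀ g, bottomNorm g ≠ 0 := fun g => (bottomNorm_pos g).ne'
    have e := continuous_entry
    refine ((hb.log hne).prodMk ?_).prodMk ?_
    · exact ((((e 0 0).mul (e 1 0)).add ((e 0 1).mul (e 1 1))).div hb hne)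
    · refine Continuous.subtype_mk ?_ _
      exact Complex.equivRealProdCLM.symm.continuous.comp
        (((e 1 1).div hb hne).prodMk ((e 1 0).neg.div hb hne))
  continuous_invFun := by
    refine Continuous.mul (Continuous.subtype_mk (continuous_matrix fun i j => ?_) _)
      (Continuous.subtype_mk (continuous_matrix fun i j => ?_) _)
    · fin_cases i <;> fin_cases j <;> simp <;> fun_prop
    · have : Continuous fun x : (ℝ × ℝ) × Circle => (x.2 : ℂ) :=
        continuous_subtype_val.comp continuous_snd
      have h1 := Complex.continuous_re.comp this
      have h2 := Complex.continuous_im.comp this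
      fin_cases i <;> fin_cases j
      exacts [h1, h2, h2.neg, h1]

/-- With the rotation on the right of the decomposition, right cosets of triangular matrices are
untouched: only the circle coordinate sees right rotations. -/
lemma iwasawa_mul_circleRot (g : SL(2, ℝ)) (z : Circle) :
    iwasawa (g * circleRot z) = ((iwasawa g).1, (iwasawa g).2 * z) := by
  rw [← iwasawa.eq_symm_apply]
  change _ = upperTri (iwasawa g).1 * circleRot ((iwasawa g).2 * z)
  rw [circleRot_mul, ← mul_assoc]
  congr 1
  exact (iwasawa.symm_apply_apply g).symm

/-- The character `(z, w) ↦ wᵃ z⁻ᵇ` of the torus. -/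
def torusChar (a b : ℤ) (z : Circle × Circle) : Circle := z.2 ^ a / z.1 ^ b

lemma continuous_torusChar (a b : ℤ) : Continuous (torusChar a b) :=
  (continuous_snd.zpow a).div' (continuous_fst.zpow b)

lemma torusChar_surjective {a : ℤ} (ha : a ≠ 0) (b : ℤ) : Function.Surjective (torusChar a b) := by
  intro z
  refine ⟨(1, Circle.exp ((z : ℂ).arg / a)), ?_⟩
  have ha' : (a : ℝ) ≠ 0 := by exact_mod_cast ha
  rw [torusChar, _root_.one_zpow, div_one, ← Circle.exp_intCast_mul, mul_div_cancel₀ _ ha', Circle.exp_arg]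

lemma torusChar_div (a b : ℤ) (z w : Circle × Circle) :
    torusChar a b (z / w) = torusChar a b z / torusChar a b w := by
  simp only [torusChar, Prod.fst_div, Prod.snd_div, div_zpow]
  exact div_div_div_comm _ _ _ _

/-- At angles `(α, β)` the character is `exp(i N'(qβ - pα))`; on `ε_i(θ)` the exponent becomes `2π i
q'` times the imaginary unit, with `i` here the index, because `N'q/N = q'`. The converse is a
Bézout argument. -/
lemma torusChar_eq_one_iff {N : ℕ} {q p d N' q' : ℤ} (hN0 : N ≠ 0) (hq0 : q ≠ 0)
    (hqp : IsCoprime q p) (hN : (N : ℤ) = d * N') (hq : q = d * q') (hc : IsCoprime N' q')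
    (z w : Circle) :
    torusChar (N' * q) (N' * p) (z, w) = 1 ↔
      ∃ (i : ℤ) (θ : ℝ), z = Circle.exp (q * θ) ∧
        w = Circle.exp (p * θ + 2 * Real.pi / N * i) := by
  have hNR : (N : ℝ) ≠ 0 := by exact_mod_cast hN0
  have hqR : (q : ℝ) ≠ 0 := by exact_mod_cast hq0
  have hN1 : (N : ℝ) = d * N' := by exact_mod_cast hN
  have hq1 : (q : ℝ) = d * q' := by exact_mod_cast hq
  have hN'R : (N' : ℝ) ≠ 0 := fun h => hNR (by rw [hN1, h, mul_zero])
  have hdR : (d : ℝ) ≠ 0 := fun h => hNR (by rw [hN1, h, zero_mul])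
  have hq'R : (q' : ℝ) ≠ 0 := fun h => hqR (by rw [hq1, h, mul_zero])
  have hexp : ∀ α β : ℝ, torusChar (N' * q) (N' * p) (Circle.exp α, Circle.exp β) =
      Circle.exp (N' * (q * β - p * α)) := by
    intro α β
    rw [torusChar, ← Circle.exp_intCast_mul, ← Circle.exp_intCast_mul, ← Circle.exp_sub]
    congr 1
    push_cast
    ring
  constructor
  · intro h
    have hz := Circle.exp_arg z
    have hw := Circle.exp_arg w
    set α := (z : ℂ).arg
    set β := (w : ℂ).arg
    rw [← hz, ← hw, hexp, ← Circle.exp_zero, Circle.exp_eq_exp] at h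
    obtain ⟨k, hk⟩ := h
    -- Given `N'(qβ - pα) = 2πk`, one seeks `θ = (α + 2πm)/q` and an index `i` with `β = pθ +
    -- 2πi/N`. This amounts to `k = N'p m + q' i`, solvable because `N'p` and `q'` are coprime: `m =
    -- ka`, `i = kb`.
    have hc' : IsCoprime (N' * p) q' :=
      IsCoprime.mul_left hc (IsCoprime.of_mul_left_right (hq ▸ hqp : IsCoprime (d * q') p)).symm
    obtain ⟨a, b, hab⟩ := hc'
    have habR : (a * (N' * p) + b * q' : ℝ) = 1 := by exact_mod_cast hab
    refine ⟨k * b, (α + 2 * Real.pi * (k * a)) / q, ?_, ?_⟩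
    · rw [← hz, Circle.exp_eq_exp]
      refine ⟨-(k * a), ?_⟩
      rw [mul_div_cancel₀ _ hqR]
      push_cast
      ring
    · rw [← hw]
      congr 1
      have e : (N' : ℝ) * q * β = N' * q * (p * ((α + 2 * Real.pi * (k * a)) / q) +
          2 * Real.pi / N * ((k * b : ℤ) : ℝ)) := by
        have e1 : (N' : ℝ) * q * (p * ((α + 2 * Real.pi * (k * a)) / q)) =
            N' * p * (α + 2 * Real.pi * (k * a)) := by field_simp
        have e2 : (N' : ℝ) * q * (2 * Real.pi / N * (k * b)) = 2 * Real.pi * (k * b * q') := by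
          rw [hN1, hq1]; field_simp
        rw [mul_add]
        push_cast
        rw [e1, e2]
        linear_combination hk - 2 * Real.pi * k * habR
      exact mul_left_cancel₀ (mul_ne_zero hN'R hqR) e
  · rintro ⟨i, θ, rfl, rfl⟩
    rw [hexp, ← Circle.exp_zero, Circle.exp_eq_exp]
    refine ⟨i * q', ?_⟩
    rw [hN1, hq1]
    push_cast
    field_simp
    ring

/-- Two quotient maps with the same fibres have homeomorphic targets. -/
lemma exists_homeomorph_of_isQuotientMap {X Y Z : Type*} [TopologicalSpace X]
    [TopologicalSpace Y] [TopologicalSpace Z] {f : X → Y} {g : X → Z}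
    (hf : Topology.IsQuotientMap f) (hg : Topology.IsQuotientMap g)
    (h : ∀ a b, f a = f b ↔ g a = g b) : ∃ e : Y ≃ₜ Z, ∀ x, e (f x) = g x := by
  let k : Y → Z := g ∘ Function.surjInv hf.surjective
  have hk : ∀ x, k (f x) = g x := fun x =>
    (h _ _).1 (Function.surjInv_eq hf.surjective (f x))
  have hkf : k ∘ f = g := funext hk
  have hinj : Function.Injective k := by
    intro y y' e
    obtain ⟨x, rfl⟩ := hf.surjective y
    obtain ⟨x', rfl⟩ := hf.surjective y'
    rwa [hk, hk, ← h] at e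
  -- As `k ∘ f = g` is a quotient map, so is `k`; an injective quotient map is a homeomorphism.
  have hquot : Topology.IsQuotientMap k :=
    Topology.IsQuotientMap.of_comp hf.continuous (hf.continuous_iff.2 (hkf ▸ hg.continuous))
      (hkf ▸ hg)
  exact ⟨(isHomeomorph_iff_isQuotientMap_injective.2 ⟨hquot, hinj⟩).homeomorph k, hk⟩

/-- The map `𝒢 → ℝ⁴ × S¹` given by the Iwasawa coordinates and a character of the torus. -/
def cosetMap (a b : ℤ) (g : SLxSL) : ((ℝ × ℝ) × (ℝ × ℝ)) × Circle :=
  (((iwasawa g.1).1, (iwasawa g.2).1), torusChar a b ((iwasawa g.1).2, (iwasawa g.2).2))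

/-- The only non-homeomorphic ingredient is the character, which is proper because the torus is
compact. -/
lemma isProperMap_cosetMap (a b : ℤ) : IsProperMap (cosetMap a b) := by
  have h1 : IsProperMap (Prod.map id (torusChar a b) :
      ((ℝ × ℝ) × (ℝ × ℝ)) × (Circle × Circle) → ((ℝ × ℝ) × (ℝ × ℝ)) × Circle) :=
    isProperMap_id.prodMap (continuous_torusChar a b).isProperMap
  exact h1.comp ((iwasawa.prodCongr iwasawa).trans
    (Homeomorph.prodProdProdComm _ _ _ _)).isProperMap

lemma cosetMap_surjective {a : ℤ} (ha : a ≠ 0) (b : ℤ) : Function.Surjective (cosetMap a b) :=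
  (Function.surjective_id.prodMap (torusChar_surjective ha b)).comp
    ((iwasawa.prodCongr iwasawa).trans (Homeomorph.prodProdProdComm _ _ _ _)).surjective

/-- Two elements lie in one coset of `H` exactly when their triangular coordinates agree and the
ratio of their torus coordinates lies in the kernel of the character. -/
lemma cosetMap_eq_iff {N : ℕ} {q p d N' q' : ℤ} (hN0 : N ≠ 0) (hq0 : q ≠ 0)
    (hqp : IsCoprime q p) (hN : (N : ℤ) = d * N') (hq : q = d * q') (hc : IsCoprime N' q')
    (g h : SLxSL) :
    cosetMap (N' * q) (N' * p) g = cosetMap (N' * q) (N' * p) h ↔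
      g⁻¹ * h ∈ littleGroup N q p := by
  have key := torusChar_eq_one_iff hN0 hq0 hqp hN hq hc
  constructor
  · intro e
    obtain ⟨e1, e2⟩ := Prod.ext_iff.1 e
    obtain ⟨e3, e4⟩ := Prod.ext_iff.1 e1
    simp only [cosetMap] at e2 e3 e4
    have e5 := (torusChar_div (N' * q) (N' * p) ((iwasawa h.1).2, (iwasawa h.2).2)
      ((iwasawa g.1).2, (iwasawa g.2).2)).trans (div_eq_one.2 e2.symm)
    obtain ⟨i, θ, hz, hw⟩ := (key _ _).1 e5
    refine ⟨i, θ, ?_⟩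
    rw [inv_mul_eq_iff_eq_mul]
    refine Prod.ext ?_ ?_
    · apply iwasawa.injective
      change _ = iwasawa (g.1 * rot (q * θ))
      rw [← circleRot_exp, iwasawa_mul_circleRot, ← hz, e3]
      exact Prod.ext rfl (by simp)
    · apply iwasawa.injective
      change _ = iwasawa (g.2 * rot (p * θ + 2 * Real.pi / N * i))
      rw [← circleRot_exp, iwasawa_mul_circleRot, ← hw, e4]
      exact Prod.ext rfl (by simp)
  · rintro ⟨i, θ, e⟩
    rw [inv_mul_eq_iff_eq_mul] at e
    have h1 : iwasawa h.1 = ((iwasawa g.1).1, (iwasawa g.1).2 * Circle.exp (q * θ)) := by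
      rw [← iwasawa_mul_circleRot, circleRot_exp, e]; rfl
    have h2 : iwasawa h.2 = ((iwasawa g.2).1,
        (iwasawa g.2).2 * Circle.exp (p * θ + 2 * Real.pi / N * i)) := by
      rw [← iwasawa_mul_circleRot, circleRot_exp, e]; rfl
    have h3 := (key _ _).2 ⟨i, θ, rfl, rfl⟩
    have h4 := torusChar_div (N' * q) (N' * p) ((iwasawa h.1).2, (iwasawa h.2).2)
      ((iwasawa g.1).2, (iwasawa g.2).2)
    rw [h1, h2] at h4
    simp only [Prod.mk_div_mk, mul_div_cancel_left] at h4
    rw [h3, eq_comm, div_eq_one] at h4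
    simp only [cosetMap, h1, h2, h4]

/-- A proper surjection onto `ℝ⁴ × S¹` whose fibres are the left cosets of `H(N,q,p)`. -/
lemma exists_isProperMap_littleGroup {N : ℕ} {q p : ℤ} (hN0 : N ≠ 0) (hq0 : q ≠ 0)
    (hqp : IsCoprime q p) :
    ∃ f : SLxSL → EuclideanSpace ℝ (Fin 4) × Circle, IsProperMap f ∧ Function.Surjective f ∧
      ∀ g h, f g = f h ↔ g⁻¹ * h ∈ littleGroup N q p := by
  have hg : 0 < Int.gcd N q := Int.gcd_pos_of_ne_zero_right _ hq0
  obtain ⟨N', q', hc, hN, hq⟩ := Int.exists_gcd_one hg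
  have hN' : N' ≠ 0 := fun h => hN0 (by rw [h, zero_mul] at hN; exact_mod_cast hN)
  let e : ((ℝ × ℝ) × (ℝ × ℝ)) ≃L[ℝ] EuclideanSpace ℝ (Fin 4) :=
    ContinuousLinearEquiv.ofFinrankEq (by simp)
  let E := e.toHomeomorph.prodCongr (Homeomorph.refl Circle)
  refine ⟨E ∘ cosetMap (N' * q) (N' * p),
    E.isProperMap.comp (isProperMap_cosetMap _ _),
    E.surjective.comp (cosetMap_surjective (mul_ne_zero hN' hq0) _), fun g h => ?_⟩
  rw [Function.comp_apply, Function.comp_apply, E.injective.eq_iff]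
  exact cosetMap_eq_iff hN0 hq0 hqp (hN.trans (mul_comm _ _)) (hq.trans (mul_comm _ _))
    (Int.isCoprime_iff_gcd_eq_one.2 hc) g h

/-! ### The coset space as a quotient of `𝒢` -/

lemma isQuotientMap_littleQuotient_mk (N : ℕ) (q p : ℤ) :
    Topology.IsQuotientMap (LittleQuotient.mk N q p) :=
  QuotientGroup.isQuotientMap_mk (littleGroup N q p)

lemma littleQuotient_mk_eq_iff (N : ℕ) (q p : ℤ) (g h : SLxSL) :
    LittleQuotient.mk N q p g = LittleQuotient.mk N q p h ↔ g⁻¹ * h ∈ littleGroup N q p :=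
  QuotientGroup.eq

/-- Properness is recorded because it makes preimages of compact sets of cosets compact, so that the
image of a Haar measure is finite on compacts. -/
lemma exists_homeomorph_littleQuotient {N : ℕ} {q p : ℤ} (hN0 : N ≠ 0) (hq0 : q ≠ 0)
    (hqp : IsCoprime q p) :
    ∃ e : LittleQuotient N q p ≃ₜ EuclideanSpace ℝ (Fin 4) × Circle,
      IsProperMap (e ∘ LittleQuotient.mk N q p) := by
  obtain ⟨f, hf, hs, h⟩ := exists_isProperMap_littleGroup (N := N) (p := p) hN0 hq0 hqp
  obtain ⟨e, he⟩ := exists_homeomorph_of_isQuotientMap (isQuotientMap_littleQuotient_mk N q p)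
    (hf.isClosedMap.isQuotientMap hf.continuous hs)
    fun a b => (littleQuotient_mk_eq_iff N q p a b).trans (h a b).symm
  exact ⟨e, (funext he : e ∘ LittleQuotient.mk N q p = f) ▸ hf⟩

/-! ### Norm estimates for the dual action -/

/-- The squared Hilbert–Schmidt norm `a² + b² + c² + d²`. -/
def hsSq (g : SL(2, ℝ)) : ℝ := g 0 0 ^ 2 + g 0 1 ^ 2 + g 1 0 ^ 2 + g 1 1 ^ 2

lemma hsSq_inv (g : SL(2, ℝ)) : hsSq g⁻¹ = hsSq g := by
  simp [hsSq, Matrix.SpecialLinearGroup.coe_inv, Matrix.adjugate_fin_two]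
  ring

lemma two_le_hsSq (g : SL(2, ℝ)) : 2 ≤ hsSq g := by
  have := det_SL g
  unfold hsSq
  nlinarith [sq_nonneg (g 0 0 - g 1 1), sq_nonneg (g 0 1 + g 1 0)]

lemma continuous_hsSq : Continuous hsSq :=
  ((((continuous_entry 0 0).pow 2).add ((continuous_entry 0 1).pow 2)).add
    ((continuous_entry 1 0).pow 2)).add ((continuous_entry 1 1).pow 2)

/-- Cauchy–Schwarz for the two linear forms `xa + c` and `xb + d`; the hints are the Lagrange
remainders. -/
lemma kF_sq_le (g : SL(2, ℝ)) (x : ℝ) : kF g x ^ 2 ≤ hsSq g := by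
  rw [kF_sq, div_le_iff₀ (by positivity), hsSq, denF, numF]
  nlinarith [sq_nonneg (g 0 0 - x * g 1 0), sq_nonneg (g 0 1 - x * g 1 1)]

lemma denF_sq_add_numF_sq_rot (θ x : ℝ) :
    denF (rot θ) x ^ 2 + numF (rot θ) x ^ 2 = 1 + x ^ 2 := by
  have := Real.sin_sq_add_cos_sq θ
  simp only [denF, numF, rot]
  simp
  linear_combination (1 + x ^ 2) * this

lemma kF_rot (θ x : ℝ) : kF (rot θ) x = 1 := by
  rw [kF, denF_sq_add_numF_sq_rot, div_self (by positivity), Real.sqrt_one]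

/-- A linear form is its length times a unit form, and `numF (rot θ) x = x cos θ - sin θ` runs
through all unit forms; hence the argument of `u - iv`. -/
lemma exists_sq_eq_numF_rot (u v : ℝ) :
    ∃ θ, ∀ x, (x * u + v) ^ 2 = (u ^ 2 + v ^ 2) * numF (rot θ) x ^ 2 := by
  refine ⟨Complex.arg ⟨u, -v⟩, fun x => ?_⟩
  have h1 := Complex.norm_mul_cos_arg ⟨u, -v⟩
  have h2 := Complex.norm_mul_sin_arg ⟨u, -v⟩
  have h3 : ‖(⟨u, -v⟩ : ℂ)‖ ^ 2 = u ^ 2 + v ^ 2 := by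
    rw [Complex.sq_norm, Complex.normSq_apply]; ring
  simp only at h1 h2
  rw [← h3, ← mul_pow]
  congr 1
  simp only [numF, rot]
  simp
  linear_combination (-x) * h1 + h2

/-- One column of `g` carries at least half of `hsSq g`; the linear form of the other column is
dropped. Thus `k_g` can be small relative to `g` only near one point of the projective line. -/
lemma exists_rot_le_kF_sq (g : SL(2, ℝ)) :
    ∃ θ, ∀ x, hsSq g / 2 * (numF (rot θ) x ^ 2 / (1 + x ^ 2)) ≤ kF g x ^ 2 := by
  rcases le_total (hsSq g / 2) (g 0 0 ^ 2 + g 1 0 ^ 2) with h | h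
  · obtain ⟨θ, hθ⟩ := exists_sq_eq_numF_rot (g 0 0) (g 1 0)
    refine ⟨θ, fun x => ?_⟩
    rw [kF_sq, mul_div_assoc']
    gcongr
    calc hsSq g / 2 * numF (rot θ) x ^ 2
        ≤ (g 0 0 ^ 2 + g 1 0 ^ 2) * numF (rot θ) x ^ 2 := by gcongr
      _ = numF g x ^ 2 := (hθ x).symm
      _ ≤ _ := by nlinarith [sq_nonneg (denF g x)]
  · obtain ⟨θ, hθ⟩ := exists_sq_eq_numF_rot (g 0 1) (g 1 1)
    refine ⟨θ, fun x => ?_⟩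
    rw [kF_sq, mul_div_assoc']
    have h' : hsSq g / 2 ≤ g 0 1 ^ 2 + g 1 1 ^ 2 := by unfold hsSq at h ⊢; linarith
    gcongr
    calc hsSq g / 2 * numF (rot θ) x ^ 2
        ≤ (g 0 1 ^ 2 + g 1 1 ^ 2) * numF (rot θ) x ^ 2 := by gcongr
      _ = denF g x ^ 2 := (hθ x).symm
      _ ≤ _ := by nlinarith [sq_nonneg (numF g x)]

instance isFiniteMeasure_lineMeasure : IsFiniteMeasure lineMeasure :=
  isFiniteMeasure_withDensity_ofReal integrable_inv_one_add_sq.2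

instance isFiniteMeasure_torusMeasure : IsFiniteMeasure torusMeasure := by
  unfold torusMeasure; infer_instance

lemma measurePreserving_mob_rot (θ : ℝ) :
    MeasurePreserving (mob (rot θ)) lineMeasure lineMeasure := by
  refine ⟨measurable_mob _, ?_⟩
  have h := map_mob (rot θ)
  simpa [kF_rot] using h

/-- The set is an arc around the zero of `numF (rot θ)`, and the rotation moves it, up to a null
set, to the arc around `0`. Its measure is therefore independent of `θ`, which later makes the
constants uniform in `g`. -/
lemma lineMeasure_numF_rot_lt (θ δ : ℝ) :
    lineMeasure {x | numF (rot θ) x ^ 2 < δ * (1 + x ^ 2)} =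
      lineMeasure {y | y ^ 2 < δ * (1 + y ^ 2)} := by
  have hm : MeasurableSet {y : ℝ | y ^ 2 < δ * (1 + y ^ 2)} :=
    measurableSet_lt (by fun_prop) (by fun_prop)
  rw [← (measurePreserving_mob_rot θ).measure_preimage hm.nullMeasurableSet]
  refine measure_congr ?_
  filter_upwards [lineMeasure_ac.ae_le (ae_denF_ne_zero (rot θ))] with x hx
  apply propext
  change numF (rot θ) x ^ 2 < δ * (1 + x ^ 2) ↔ mob (rot θ) x ^ 2 < δ * (1 + mob (rot θ) x ^ 2)
  have hp : 0 < denF (rot θ) x ^ 2 := by positivity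
  rw [one_add_mob_sq _ _ hx, denF_sq_add_numF_sq_rot, mob, div_pow, mul_div_assoc',
    div_lt_div_iff_of_pos_right hp]

/-- As `δ` tends to `0` the arcs shrink to the null set `{0}`. -/
lemma exists_lineMeasure_lt {ε : ℝ≥0∞} (hε : 0 < ε) :
    ∃ δ : ℝ, 0 < δ ∧ lineMeasure {y | y ^ 2 < δ * (1 + y ^ 2)} < ε := by
  have hm : ∀ n : ℕ, MeasurableSet {y : ℝ | y ^ 2 < 1 / ((n : ℝ) + 1) * (1 + y ^ 2)} := fun n =>
    measurableSet_lt (by fun_prop) (by fun_prop)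
  have h := tendsto_measure_iInter_atTop (μ := lineMeasure) (fun n => (hm n).nullMeasurableSet)
    (fun m n hmn y (hy : y ^ 2 < _) => lt_of_lt_of_le hy (by gcongr)) ⟨0, measure_ne_top _ _⟩
  have h0 : lineMeasure (⋂ n : ℕ, {y : ℝ | y ^ 2 < 1 / ((n : ℝ) + 1) * (1 + y ^ 2)}) = 0 := by
    refine lineMeasure_ac (measure_mono_null (t := {0}) (fun y hy => ?_) Real.volume_singleton)
    have hlim : Filter.Tendsto (fun n : ℕ => 1 / ((n : ℝ) + 1) * (1 + y ^ 2)) Filter.atTop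
        (nhds (0 * (1 + y ^ 2))) := tendsto_one_div_add_atTop_nhds_zero_nat.mul_const _
    have : y ^ 2 ≤ 0 * (1 + y ^ 2) :=
      ge_of_tendsto' hlim fun n => (Set.mem_iInter.1 hy n : y ^ 2 < _).le
    rw [zero_mul] at this
    exact pow_eq_zero_iff two_ne_zero |>.1 (le_antisymm this (sq_nonneg y))
  rw [h0] at h
  obtain ⟨n, hn⟩ := (h.eventually_lt_const hε).exists
  exact ⟨1 / ((n : ℝ) + 1), by positivity, hn⟩

lemma ofReal_norm_sq_L2 (φ : L2Torus) :
    ENNReal.ofReal (‖φ‖ ^ 2) = ∫⁻ z, ENNReal.ofReal (φ z ^ 2) ∂torusMeasure := by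
  rw [← ofReal_integral_eq_lintegral_ofReal (Lp.memLp φ).integrable_sq
    (Filter.Eventually.of_forall fun z => sq_nonneg _), ← real_inner_self_eq_norm_sq, L2.inner_def]
  congr 2
  ext z
  simp [sq]

lemma coeFn_smul_L2 (g : SLxSL) (φ : L2Torus) :
    (g • φ : L2Torus) =ᵐ[torusMeasure] dualFun g φ :=
  MemLp.coeFn_toLp (memLp_dualFun g (Lp.memLp φ))

lemma kF_inv_mob (g : SL(2, ℝ)) (x : ℝ) (hx : denF g x ≠ 0) :
    kF g⁻¹ (mob g x) = (kF g x)⁻¹ := by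
  have h := kF_mul g g⁻¹ x hx
  have h1 : kF 1 x = 1 := by
    have := kF_rot 0 x
    rwa [rot_zero] at this
  rw [mul_inv_cancel, h1] at h
  exact eq_inv_of_mul_eq_one_right h.symm

/-- Of the factor `k_g⁻⁶`, the part `k_g⁻²` is the Jacobian, and the remaining `k_g⁻⁴` is rewritten
at the image point `xg` through `k_(g⁻¹)`. -/
lemma multF_sq (g : SL(2, ℝ)) (x : ℝ) (hx : denF g x ≠ 0) :
    multF g x ^ 2 = (kF g x ^ 2)⁻¹ * kF g⁻¹ (mob g x) ^ 4 := by
  rw [kF_inv_mob g x hx, multF, sF, mul_pow, div_pow, sq_abs, div_self (pow_ne_zero 2 hx)]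
  have := (kF_pos g x).ne'
  field_simp

/-- After the substitution `z ↦ zg` the group element appears only in the weight and `φ` stays
fixed, so bounds on `k` become bounds on norms. -/
lemma ofReal_norm_sq_smul (g : SLxSL) (φ : L2Torus) :
    ENNReal.ofReal (‖g • φ‖ ^ 2) = ∫⁻ z, ENNReal.ofReal
      (kF g.1⁻¹ z.1 ^ 4 * kF g.2⁻¹ z.2 ^ 4 * φ z ^ 2) ∂torusMeasure := by
  have hφ : Measurable (φ : ℝ × ℝ → ℝ) := (Lp.stronglyMeasurable φ).measurable
  have hF : Measurable fun z : ℝ × ℝ =>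
      ENNReal.ofReal (kF g.1⁻¹ z.1 ^ 4 * kF g.2⁻¹ z.2 ^ 4 * φ z ^ 2) :=
    (((((measurable_kF _).comp measurable_fst).pow_const 4).mul
      (((measurable_kF _).comp measurable_snd).pow_const 4)).mul (hφ.pow_const 2)).ennreal_ofReal
  rw [ofReal_norm_sq_L2, ← (measurePreserving_mobPair g).lintegral_comp hF,
    lintegral_withDensity_eq_lintegral_mul (g := fun a => ENNReal.ofReal
      (kF g.1⁻¹ (mobPair g a).1 ^ 4 * kF g.2⁻¹ (mobPair g a).2 ^ 4 * φ (mobPair g a) ^ 2))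
      _ (measurable_dens g).ennreal_ofReal (hF.comp (quasi_mobPair g).measurable)]
  refine lintegral_congr_ae ?_
  filter_upwards [coeFn_smul_L2 g φ, ae_torus_denF g] with z hz hd
  rw [hz, Pi.mul_apply, ← ENNReal.ofReal_mul (dens_pos g z).le, dualFun, mul_pow, mul_pow,
    multF_sq _ _ hd.1, multF_sq _ _ hd.2]
  congr 1
  simp only [dens, mobPair, Prod.map]
  ring

lemma norm_smul_L2_le (g : SLxSL) (φ : L2Torus) : ‖g • φ‖ ≤ hsSq g.1 * hsSq g.2 * ‖φ‖ := by
  have h1 := two_le_hsSq g.1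
  have h2 := two_le_hsSq g.2
  have hk : ∀ (g : SL(2, ℝ)) (x : ℝ), kF g⁻¹ x ^ 4 ≤ hsSq g ^ 2 := fun g x => by
    have := kF_sq_le g⁻¹ x
    rw [hsSq_inv] at this
    calc kF g⁻¹ x ^ 4 = (kF g⁻¹ x ^ 2) ^ 2 := by ring
      _ ≤ _ := by gcongr
  rw [← sq_le_sq₀ (norm_nonneg _) (by positivity), ← ENNReal.ofReal_le_ofReal_iff (by positivity),
    ofReal_norm_sq_smul, mul_pow, ENNReal.ofReal_mul (by positivity), ofReal_norm_sq_L2,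
    ← lintegral_const_mul' _ _ ENNReal.ofReal_ne_top]
  refine lintegral_mono fun z => ?_
  rw [← ENNReal.ofReal_mul (by positivity), mul_pow]
  gcongr
  · exact hk _ _
  · exact hk _ _

/-- The dual action is coercive: `‖T'(g,h)φ‖ ≥ c ‖g‖² ‖h‖²`. -/
lemma exists_le_norm_smul_L2 {φ : L2Torus} (hφ : φ ≠ 0) :
    ∃ c : ℝ, 0 < c ∧ ∀ g : SLxSL, c * (hsSq g.1 * hsSq g.2) ^ 2 ≤ ‖g • φ‖ ^ 2 := by
  have hn : 0 < ‖φ‖ ^ 2 := by positivity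
  have hI := ofReal_norm_sq_L2 φ
  have hfin : ∫⁻ z, ENNReal.ofReal (φ z ^ 2) ∂torusMeasure ≠ ∞ := hI ▸ ENNReal.ofReal_ne_top
  have hε : ENNReal.ofReal (‖φ‖ ^ 2 / 2) ≠ 0 := (ENNReal.ofReal_pos.2 (by positivity)).ne'
  -- Absolute continuity of the integral: a set of measure below `η` carries less than half of
  -- `‖φ‖²`.
  obtain ⟨η, hη, hs⟩ := exists_pos_setLIntegral_lt_of_measure_lt hfin hε
  set L := lineMeasure Set.univ with hL
  have hLtop : L ≠ ∞ := measure_ne_top _ _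
  obtain ⟨δ, hδ, hδη⟩ := exists_lineMeasure_lt (ε := η / (2 * (L + 1)))
    (ENNReal.div_pos hη.ne' (ENNReal.mul_ne_top (by simp) (by simpa using hLtop)))
  -- Each of the two weights contributes `(hsSq · δ/2)²` off the bad set, and at least `‖φ‖²/2` of
  -- the mass lies there.
  refine ⟨(δ / 2) ^ 4 * (‖φ‖ ^ 2 / 2), by positivity, fun g => ?_⟩
  obtain ⟨θ₁, h₁⟩ := exists_rot_le_kF_sq g.1⁻¹
  obtain ⟨θ₂, h₂⟩ := exists_rot_le_kF_sq g.2⁻¹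
  rw [hsSq_inv] at h₁ h₂
  set E : ℝ → Set ℝ := fun θ => {x | numF (rot θ) x ^ 2 < δ * (1 + x ^ 2)} with hE
  have hEm : ∀ θ, MeasurableSet (E θ) := fun θ =>
    measurableSet_lt ((measurable_numF _).pow_const 2) (by fun_prop)
  -- The bad set: a cross of two strips on which one of the two weights may be small. It depends on
  -- `g`, but its measure bound does not.
  set B : Set (ℝ × ℝ) := E θ₁ ×ˢ Set.univ ∪ Set.univ ×ˢ E θ₂ with hB
  have hBm : MeasurableSet B :=
    ((hEm _).prod MeasurableSet.univ).union (MeasurableSet.univ.prod (hEm _))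
  have hBη : torusMeasure B < η := by
    set v := lineMeasure {y | y ^ 2 < δ * (1 + y ^ 2)} with hv
    have hEv : ∀ θ, lineMeasure (E θ) = v := fun θ => lineMeasure_numF_rot_lt θ δ
    calc torusMeasure B
        ≤ torusMeasure (E θ₁ ×ˢ Set.univ) + torusMeasure (Set.univ ×ˢ E θ₂) := measure_union_le _ _
      _ = v * (2 * L) := by
        rw [torusMeasure, Measure.prod_prod, Measure.prod_prod, hEv, hEv, ← hL]; ring
      _ ≤ v * (2 * (L + 1)) := by gcongr; exact le_self_add
      _ < η := ENNReal.mul_lt_of_lt_div hδη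
  have hcompl : ENNReal.ofReal (‖φ‖ ^ 2 / 2) ≤
      ∫⁻ z in Bᶜ, ENNReal.ofReal (φ z ^ 2) ∂torusMeasure := by
    by_contra hlt
    have h := ENNReal.add_lt_add (hs B hBη) (not_le.1 hlt)
    rw [lintegral_add_compl _ hBm, ← hI, ← ENNReal.ofReal_add (by positivity) (by positivity),
      add_halves] at h
    exact lt_irrefl _ h
  have hS1 := two_le_hsSq g.1
  have hS2 := two_le_hsSq g.2
  have key : ∀ (S θ : ℝ) (k : ℝ) (x : ℝ), 2 ≤ S → x ∉ E θ →
      S / 2 * (numF (rot θ) x ^ 2 / (1 + x ^ 2)) ≤ k ^ 2 → (S * (δ / 2)) ^ 2 ≤ k ^ 4 := by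
    intro S θ k x hS hx hk
    have hx' : δ ≤ numF (rot θ) x ^ 2 / (1 + x ^ 2) := by
      rw [le_div_iff₀ (by positivity)]
      exact not_lt.1 hx
    calc (S * (δ / 2)) ^ 2 = (S / 2 * δ) ^ 2 := by ring
      _ ≤ (k ^ 2) ^ 2 := by
        gcongr
        exact (by gcongr : S / 2 * δ ≤ S / 2 * (numF (rot θ) x ^ 2 / (1 + x ^ 2))).trans hk
      _ = k ^ 4 := by ring
  rw [← ENNReal.ofReal_le_ofReal_iff (by positivity), ofReal_norm_sq_smul]
  calc ENNReal.ofReal ((δ / 2) ^ 4 * (‖φ‖ ^ 2 / 2) * (hsSq g.1 * hsSq g.2) ^ 2)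
      = ENNReal.ofReal ((hsSq g.1 * (δ / 2)) ^ 2 * (hsSq g.2 * (δ / 2)) ^ 2) *
          ENNReal.ofReal (‖φ‖ ^ 2 / 2) := by
        rw [← ENNReal.ofReal_mul (by positivity)]
        congr 1
        ring
    _ ≤ ENNReal.ofReal ((hsSq g.1 * (δ / 2)) ^ 2 * (hsSq g.2 * (δ / 2)) ^ 2) *
          ∫⁻ z in Bᶜ, ENNReal.ofReal (φ z ^ 2) ∂torusMeasure := by gcongr
    _ = ∫⁻ z in Bᶜ, ENNReal.ofReal ((hsSq g.1 * (δ / 2)) ^ 2 * (hsSq g.2 * (δ / 2)) ^ 2) *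
          ENNReal.ofReal (φ z ^ 2) ∂torusMeasure :=
        (lintegral_const_mul' _ _ ENNReal.ofReal_ne_top).symm
    _ ≤ ∫⁻ z in Bᶜ, ENNReal.ofReal (kF g.1⁻¹ z.1 ^ 4 * kF g.2⁻¹ z.2 ^ 4 * φ z ^ 2)
          ∂torusMeasure := by
        refine setLIntegral_mono' hBm.compl fun z hz => ?_
        simp only [hB, Set.mem_compl_iff, Set.mem_union, Set.mem_prod, Set.mem_univ, and_true,
          true_and, not_or] at hz
        rw [← ENNReal.ofReal_mul (by positivity)]
        gcongr
        · exact key _ _ _ _ hS1 hz.1 (h₁ z.1)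
        · exact key _ _ _ _ hS2 hz.2 (h₂ z.2)
    _ ≤ _ := setLIntegral_le_lintegral _ _

/-! ### Strong continuity of the dual action and the topology of the orbits -/

lemma smul_sub_L2 (g : SLxSL) (φ ψ : L2Torus) : g • (φ - ψ) = g • φ - g • ψ := by
  apply Lp.ext
  filter_upwards [coeFn_smul_L2 g (φ - ψ), coeFn_smul_L2 g φ, coeFn_smul_L2 g ψ,
    Lp.coeFn_sub (g • φ) (g • ψ), (quasi_mobPair g).ae_eq (Lp.coeFn_sub φ ψ)] with z h1 h2 h3 h4 h5
  have h5' : (φ - ψ : L2Torus) (mob g.1 z.1, mob g.2 z.2) =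
      φ (mob g.1 z.1, mob g.2 z.2) - ψ (mob g.1 z.1, mob g.2 z.2) := h5
  rw [h4, Pi.sub_apply, h1, h2, h3, dualFun, dualFun, dualFun, h5', mul_sub]

lemma continuous_numF (x : ℝ) : Continuous fun g : SL(2, ℝ) => numF g x :=
  ((continuous_entry 0 0).const_mul x).add (continuous_entry 1 0)

lemma continuous_denF (x : ℝ) : Continuous fun g : SL(2, ℝ) => denF g x :=
  ((continuous_entry 0 1).const_mul x).add (continuous_entry 1 1)

lemma continuous_kF (x : ℝ) : Continuous fun g : SL(2, ℝ) => kF g x :=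
  ((((continuous_denF x).pow 2).add ((continuous_numF x).pow 2)).div_const _).sqrt

/-- The sign factor jumps where the denominator vanishes, so continuity in `g` holds only at almost
every point; that suffices for dominated convergence. -/
lemma continuousAt_multF {g : SL(2, ℝ)} {x : ℝ} (hx : denF g x ≠ 0) :
    ContinuousAt (fun g : SL(2, ℝ) => multF g x) g := by
  have h1 := (continuous_denF x).continuousAt (x := g)
  exact (((continuous_kF x).continuousAt.pow 3).inv₀ (pow_ne_zero 3 (kF_pos g x).ne')).mul
    (h1.div h1.abs (abs_ne_zero.2 hx))

lemma continuousAt_mob {g : SL(2, ℝ)} {x : ℝ} (hx : denF g x ≠ 0) :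
    ContinuousAt (fun g : SL(2, ℝ) => mob g x) g :=
  (continuous_numF x).continuousAt.div (continuous_denF x).continuousAt hx

lemma multF_sq_le (g : SL(2, ℝ)) (x : ℝ) : multF g x ^ 2 ≤ hsSq g ^ 3 := by
  have h := kF_inv_sq_le g x
  have hp : 0 < (kF g x ^ 2)⁻¹ := inv_pos.2 (pow_pos (kF_pos _ _) 2)
  have h1 := two_le_hsSq g
  calc multF g x ^ 2 = ((kF g x ^ 2)⁻¹) ^ 3 * sF g x ^ 2 := by
        unfold multF; rw [mul_pow]; congr 1; rw [← inv_pow, ← inv_pow]; ring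
    _ ≤ hsSq g ^ 3 * 1 := by
        gcongr
        · exact h
        · exact sF_sq_le g x
    _ = _ := mul_one _

lemma continuousAt_dualFun {f : ℝ × ℝ → ℝ} (hf : Continuous f) {g : SLxSL} {z : ℝ × ℝ}
    (h1 : denF g.1 z.1 ≠ 0) (h2 : denF g.2 z.2 ≠ 0) :
    ContinuousAt (fun g : SLxSL => dualFun g f z) g := by
  have e1 : ContinuousAt (fun g : SLxSL => multF g.1 z.1) g :=
    ContinuousAt.comp (f := Prod.fst) (continuousAt_multF h1) continuousAt_fst
  have e2 : ContinuousAt (fun g : SLxSL => multF g.2 z.2) g :=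
    ContinuousAt.comp (f := Prod.snd) (continuousAt_multF h2) continuousAt_snd
  have e3 : ContinuousAt (fun g : SLxSL => mob g.1 z.1) g :=
    ContinuousAt.comp (f := Prod.fst) (continuousAt_mob h1) continuousAt_fst
  have e4 : ContinuousAt (fun g : SLxSL => mob g.2 z.2) g :=
    ContinuousAt.comp (f := Prod.snd) (continuousAt_mob h2) continuousAt_snd
  exact (e1.mul e2).mul (hf.continuousAt.comp (e3.prodMk e4))

lemma measurable_dualFun (g : SLxSL) {f : ℝ × ℝ → ℝ} (hf : Measurable f) :
    Measurable (dualFun g f) :=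
  (((measurable_multF g.1).comp measurable_fst).mul
    ((measurable_multF g.2).comp measurable_snd)).mul (hf.comp (quasi_mobPair g).measurable)

lemma dualFun_sq_le (g : SLxSL) {f : ℝ × ℝ → ℝ} {C : ℝ} (hf : ∀ z, |f z| ≤ C) (z : ℝ × ℝ) :
    dualFun g f z ^ 2 ≤ hsSq g.1 ^ 3 * hsSq g.2 ^ 3 * C ^ 2 := by
  have h1 := two_le_hsSq g.1
  have h2 := two_le_hsSq g.2
  have h3 : f (mob g.1 z.1, mob g.2 z.2) ^ 2 ≤ C ^ 2 :=
    sq_le_sq' (abs_le.1 (hf _)).1 (abs_le.1 (hf _)).2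
  rw [dualFun, mul_pow, mul_pow]
  gcongr ?_ * ?_ * ?_
  · exact multF_sq_le _ _
  · exact multF_sq_le _ _

lemma continuous_smul_of_ae_eq_bounded {φ : L2Torus} {f : ℝ × ℝ → ℝ} (hf : Continuous f) {C : ℝ}
    (hC : ∀ z, |f z| ≤ C) (hφ : φ =ᵐ[torusMeasure] f) : Continuous fun g : SLxSL => g • φ := by
  have hs : ∀ g : SLxSL, (g • φ : L2Torus) =ᵐ[torusMeasure] dualFun g f := fun g => by
    filter_upwards [coeFn_smul_L2 g φ, (quasi_mobPair g).ae_eq hφ] with z h1 h2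
    have h2' : φ (mob g.1 z.1, mob g.2 z.2) = f (mob g.1 z.1, mob g.2 z.2) := h2
    rw [h1, dualFun, dualFun, h2']
  refine continuous_iff_continuousAt.2 fun g => ?_
  rw [ContinuousAt, tendsto_iff_norm_sub_tendsto_zero]
  have hnorm : ∀ h : SLxSL, ENNReal.ofReal (‖h • φ - g • φ‖ ^ 2) =
      ∫⁻ z, ENNReal.ofReal ((dualFun h f z - dualFun g f z) ^ 2) ∂torusMeasure := fun h => by
    rw [ofReal_norm_sq_L2]
    refine lintegral_congr_ae ?_
    filter_upwards [Lp.coeFn_sub (h • φ) (g • φ), hs h, hs g] with z e1 e2 e3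
    rw [e1, Pi.sub_apply, e2, e3]
  set M : SLxSL → ℝ := fun h => hsSq h.1 ^ 3 * hsSq h.2 ^ 3 * C ^ 2 with hM
  have hMc : Continuous M := (((continuous_hsSq.comp continuous_fst).pow 3).mul
    ((continuous_hsSq.comp continuous_snd).pow 3)).mul_const _
  have hlim : Filter.Tendsto (fun h : SLxSL => ∫⁻ z, ENNReal.ofReal
      ((dualFun h f z - dualFun g f z) ^ 2) ∂torusMeasure) (nhds g)
      (nhds (∫⁻ _, 0 ∂torusMeasure)) := by
    refine tendsto_lintegral_filter_of_dominated_convergence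
      -- From `(a - b)² ≤ 2a² + 2b²`, with `M h < M g + 1` for `h` near `g`; a constant is
      -- integrable since the torus has finite measure.
      (fun _ => ENNReal.ofReal (2 * (M g + 1) + 2 * M g)) ?_ ?_ ?_ ?_
    · exact Filter.Eventually.of_forall fun h => (((measurable_dualFun h hf.measurable).sub
        (measurable_dualFun g hf.measurable)).pow_const 2).ennreal_ofReal
    · filter_upwards [hMc.continuousAt.eventually_lt continuousAt_const (lt_add_one (M g))]
        with h hh
      refine Filter.Eventually.of_forall fun z => ENNReal.ofReal_le_ofReal ?_
      have h1 := dualFun_sq_le h hC z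
      have h2 := dualFun_sq_le g hC z
      have h3 : (dualFun h f z - dualFun g f z) ^ 2 ≤
          2 * dualFun h f z ^ 2 + 2 * dualFun g f z ^ 2 := by
        nlinarith [sq_nonneg (dualFun h f z + dualFun g f z)]
      have h4 : dualFun h f z ^ 2 ≤ M g + 1 := h1.trans hh.le
      have h5 : dualFun g f z ^ 2 ≤ M g := h2
      linarith
    · rw [lintegral_const]
      exact ENNReal.mul_ne_top ENNReal.ofReal_ne_top (measure_ne_top _ _)
    · filter_upwards [ae_torus_denF g] with z hz
      have := (((continuousAt_dualFun hf hz.1 hz.2).sub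
        (continuousAt_const (y := dualFun g f z))).pow 2).tendsto
      have := ENNReal.tendsto_ofReal this
      simpa using this
  rw [lintegral_zero] at hlim
  simp only [← hnorm] at hlim
  have h2 := (ENNReal.tendsto_toReal ENNReal.zero_ne_top).comp hlim
  have h3 : Filter.Tendsto (fun h : SLxSL => ‖h • φ - g • φ‖ ^ 2) (nhds g) (nhds 0) := by
    refine h2.congr fun h => ?_
    exact ENNReal.toReal_ofReal (by positivity)
  have h4 := h3.sqrt
  simpa [Real.sqrt_sq] using h4

/-- The dual action is strongly continuous. -/
lemma continuous_smul_L2 (φ : L2Torus) : Continuous fun g : SLxSL => g • φ := by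
  refine continuous_of_locally_uniform_approx_of_continuousAt fun g u hu => ?_
  obtain ⟨ε, hε, hεu⟩ := Metric.mem_uniformity_dist.1 hu
  set M : SLxSL → ℝ := fun h => hsSq h.1 * hsSq h.2 with hM
  have hMc : Continuous M :=
    (continuous_hsSq.comp continuous_fst).mul (continuous_hsSq.comp continuous_snd)
  have hMpos : ∀ h, 0 < M h := fun h =>
    mul_pos (by linarith [two_le_hsSq h.1]) (by linarith [two_le_hsSq h.2])
  have hpos : 0 < M g + 1 := by linarith [hMpos g]
  -- The operators near `g` have norm at most `M g + 1`, so a bounded continuous `ψ` within `ε / (M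
  -- g + 1)` of `φ` approximates the orbit map locally uniformly.
  obtain ⟨ψ, hψ, hd⟩ := Metric.dense_iff.1
    (Lp.boundedContinuousFunction_dense ℝ torusMeasure (p := 2) (by simp)) φ
    (ε / (M g + 1)) (by positivity)
  obtain ⟨f, hf⟩ := Lp.mem_boundedContinuousFunction_iff.1 hd
  have hψf : ψ =ᵐ[torusMeasure] f := by
    have := AEEqFun.coeFn_mk (μ := torusMeasure) f f.continuous.aestronglyMeasurable
    rw [← hf]; exact this
  refine ⟨{h | M h < M g + 1}, (hMc.isOpen_preimage _ isOpen_Iio).mem_nhds (lt_add_one (M g)),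
    fun h => h • ψ, (continuous_smul_of_ae_eq_bounded f.continuous
      (fun z => f.norm_coe_le_norm z) hψf).continuousAt, fun h hh => hεu ?_⟩
  rw [dist_eq_norm, ← smul_sub_L2]
  have h1 : ‖φ - ψ‖ < ε / (M g + 1) := by
    rw [← dist_eq_norm, dist_comm]; exact hψ
  calc ‖h • (φ - ψ)‖ ≤ M h * ‖φ - ψ‖ := norm_smul_L2_le h _
    _ ≤ (M g + 1) * ‖φ - ψ‖ := by gcongr; exact le_of_lt hh
    _ < (M g + 1) * (ε / (M g + 1)) := by gcongr
    _ = ε := mul_div_cancel₀ _ hpos.ne'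

/-! ### Properness of orbit maps and the topology of orbits -/

lemma isCompact_hsSq_le (C : ℝ) : IsCompact {g : SL(2, ℝ) | hsSq g ≤ C} := by
  have hcl : Topology.IsClosedEmbedding
      (fun g : SL(2, ℝ) => (fun i j => g i j : Fin 2 → Fin 2 → ℝ)) := by
    refine IsClosed.isClosedEmbedding_subtypeVal
      (s := {A : Matrix (Fin 2) (Fin 2) ℝ | A.det = 1}) ?_
    exact isClosed_eq (Continuous.matrix_det continuous_id) continuous_const
  have hK : IsCompact (Set.pi Set.univ fun _ : Fin 2 =>
      Set.pi Set.univ fun _ : Fin 2 => Set.Icc (-(C + 1)) (C + 1)) :=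
    isCompact_univ_pi fun _ => isCompact_univ_pi fun _ => isCompact_Icc
  refine (hcl.isCompact_preimage hK).of_isClosed_subset
    (isClosed_le continuous_hsSq continuous_const) fun g hg => ?_
  have hg' : g 0 0 ^ 2 + g 0 1 ^ 2 + g 1 0 ^ 2 + g 1 1 ^ 2 ≤ C := hg
  have key : ∀ t : ℝ, t ^ 2 ≤ C → t ∈ Set.Icc (-(C + 1)) (C + 1) := fun t ht =>
    ⟨by nlinarith [sq_nonneg (t + 1)], by nlinarith [sq_nonneg (t - 1)]⟩
  intro i _ j _
  apply key
  fin_cases i <;> fin_cases j <;> simp only [Fin.zero_eta, Fin.mk_one] <;>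
    nlinarith [sq_nonneg (g 0 0), sq_nonneg (g 0 1), sq_nonneg (g 1 0), sq_nonneg (g 1 1)]

/-- The orbit map of a non-zero vector is proper. -/
lemma isProperMap_smul_L2 {φ : L2Torus} (hφ : φ ≠ 0) : IsProperMap fun g : SLxSL => g • φ := by
  rw [isProperMap_iff_isCompact_preimage]
  refine ⟨continuous_smul_L2 φ, fun K hK => ?_⟩
  obtain ⟨R, hR⟩ := hK.isBounded.exists_norm_le
  obtain ⟨c, hc, h⟩ := exists_le_norm_smul_L2 hφ
  set C := R ^ 2 / c + 1 with hC
  refine ((isCompact_hsSq_le C).prod (isCompact_hsSq_le C)).of_isClosed_subset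
    (hK.isClosed.preimage (continuous_smul_L2 φ)) fun g hg => ?_
  have h1 := two_le_hsSq g.1
  have h2 := two_le_hsSq g.2
  have h3 : (hsSq g.1 * hsSq g.2) ^ 2 ≤ R ^ 2 / c := by
    rw [le_div_iff₀' hc]
    exact (h g).trans (by gcongr; exact hR _ hg)
  -- The `+ 1` in `C` allows `t ≤ t² + 1`; each factor is then at most `C` because the other is at
  -- least `2`.
  have h4 : hsSq g.1 * hsSq g.2 ≤ C := by nlinarith
  exact ⟨show hsSq g.1 ≤ C by nlinarith, show hsSq g.2 ≤ C by nlinarith⟩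

/-- A proper map is closed, also onto its image with the subspace topology, and a continuous closed
surjection is a quotient map. -/
lemma isQuotientMap_orbit {φ : L2Torus} (hφ : φ ≠ 0) :
    Topology.IsQuotientMap fun g : SLxSL =>
      (⟨g • φ, MulAction.mem_orbit φ g⟩ : MulAction.orbit SLxSL φ) := by
  have hc : Continuous fun g : SLxSL =>
      (⟨g • φ, MulAction.mem_orbit φ g⟩ : MulAction.orbit SLxSL φ) :=
    (continuous_smul_L2 φ).subtype_mk _
  refine IsClosedMap.isQuotientMap (fun s hs => ?_) hc ?_
  · have := ((isProperMap_smul_L2 hφ).isClosedMap s hs).preimage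
      (continuous_subtype_val (p := fun ψ => ψ ∈ MulAction.orbit SLxSL φ))
    convert this using 1
    ext ψ
    constructor
    · rintro ⟨g, hg, rfl⟩
      exact ⟨g, hg, rfl⟩
    · rintro ⟨g, hg, e⟩
      exact ⟨g, hg, Subtype.ext e⟩
  · rintro ⟨_, g, rfl⟩
    exact ⟨g, rfl⟩

lemma nonempty_homeomorph_orbit {N : ℕ} {q p : ℤ} (hN0 : N ≠ 0) (hq0 : q ≠ 0)
    (hqp : IsCoprime q p) {φ : L2Torus}
    (hφ : MulAction.stabilizer SLxSL φ = littleGroup N q p) :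
    Nonempty (MulAction.orbit SLxSL φ ≃ₜ EuclideanSpace ℝ (Fin 4) × Circle) := by
  obtain ⟨f, hf, hs, h⟩ := exists_isProperMap_littleGroup (N := N) (p := p) hN0 hq0 hqp
  -- The zero vector is fixed by all of `𝒢`, in particular by a non-trivial unipotent element, which
  -- is not a rotation.
  have h0 : φ ≠ 0 := by
    rintro rfl
    have hmem : ((upperTri (0, 1), 1) : SLxSL) ∈ littleGroup N q p := by
      rw [← hφ, MulAction.mem_stabilizer_iff]
      simpa using smul_sub_L2 (upperTri (0, 1), 1) 0 0
    obtain ⟨i, θ, e⟩ := hmem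
    have e1 : upperTri (0, 1) = rot (q * θ) := congrArg Prod.fst e
    have e2 : (1 : ℝ) = Real.sin (q * θ) := congrFun (congrFun (congrArg Subtype.val e1) 0) 1
    have e3 : (0 : ℝ) = -Real.sin (q * θ) := congrFun (congrFun (congrArg Subtype.val e1) 1) 0
    linarith
  obtain ⟨e, -⟩ := exists_homeomorph_of_isQuotientMap (isQuotientMap_orbit h0)
    (hf.isClosedMap.isQuotientMap hf.continuous hs) fun a b => by
      rw [h, ← hφ, MulAction.mem_stabilizer_iff, mul_smul, inv_smul_eq_iff, Subtype.mk.injEq,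
        eq_comm]
  exact ⟨e⟩

/-! ### The invariant measure on the coset space -/

instance locallyCompactSpace_SL2R : LocallyCompactSpace SL(2, ℝ) :=
  iwasawa.isClosedEmbedding.locallyCompactSpace

lemma hsSq_mul_rot (g : SL(2, ℝ)) (θ : ℝ) : hsSq (g * rot θ) = hsSq g := by
  have h := Real.sin_sq_add_cos_sq θ
  simp only [hsSq, Matrix.SpecialLinearGroup.coe_mul, Matrix.mul_apply, Fin.sum_univ_two]
  simp [rot]
  linear_combination (g 0 0 ^ 2 + g 0 1 ^ 2 + g 1 0 ^ 2 + g 1 1 ^ 2) * h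

lemma hsSq_one : hsSq 1 = 2 := by
  simp [hsSq]; norm_num

/-- A Haar measure of `𝒢` is invariant under right translation by rotations. -/
lemma map_mul_right_rot (μ : Measure SLxSL) [μ.IsHaarMeasure] (α β : ℝ) :
    μ.map (· * ((rot α, rot β) : SLxSL)) = μ := by
  set k : SLxSL := (rot α, rot β) with hk
  -- Right translation multiplies `μ` by a scalar. It preserves this compact set of positive
  -- measure, since `hsSq` is right invariant under rotations, so the scalar is `1`.
  set B : Set SLxSL := {g | hsSq g ≤ 3} ×ˢ {g | hsSq g ≤ 3} with hB
  have hBc : IsCompact B := (isCompact_hsSq_le 3).prod (isCompact_hsSq_le 3)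
  have hpre : (· * k) ⁻¹' B = B := by
    ext g
    change hsSq (g.1 * rot α) ≤ 3 ∧ hsSq (g.2 * rot β) ≤ 3 ↔ hsSq g.1 ≤ 3 ∧ hsSq g.2 ≤ 3
    rw [hsSq_mul_rot, hsSq_mul_rot]
  have hB0 : μ B ≠ 0 := by
    have hU : IsOpen ({g : SL(2, ℝ) | hsSq g < 3} ×ˢ {g : SL(2, ℝ) | hsSq g < 3}) :=
      (isOpen_lt continuous_hsSq continuous_const).prod
        (isOpen_lt continuous_hsSq continuous_const)
    have h1 : hsSq 1 < 3 := by rw [hsSq_one]; norm_num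
    refine (lt_of_lt_of_le (hU.measure_pos μ ⟨(1, 1), h1, h1⟩) (measure_mono ?_)).ne'
    exact Set.prod_mono (fun g (hg : hsSq g < 3) => hg.le) fun g (hg : hsSq g < 3) => hg.le
  have h := Measure.isMulLeftInvariant_eq_smul (μ.map (· * k)) μ
  set c := Measure.haarScalarFactor (μ.map (· * k)) μ
  have hc : μ B = c * μ B := by
    conv_lhs => rw [← hpre, ← Measure.map_apply (measurable_mul_const k) hBc.measurableSet, h]
    rfl
  have hc1 : (c : ℝ≥0∞) = 1 := by
    have := (ENNReal.mul_left_inj hB0 hBc.measure_lt_top.ne).1 ((one_mul _).trans hc)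
    exact this.symm
  rw [h, ENNReal.coe_eq_one.1 hc1, one_smul]

section

variable (N : ℕ) (q p : ℤ)

instance : ContinuousConstSMul SLxSL (LittleQuotient N q p) :=
  inferInstanceAs (ContinuousConstSMul SLxSL (SLxSL ⧸ littleGroup N q p))

lemma smul_littleQuotient_mk (g h : SLxSL) :
    g • LittleQuotient.mk N q p h = LittleQuotient.mk N q p (g * h) := rfl

lemma map_mul_right_littleGroup (μ : Measure SLxSL) [μ.IsHaarMeasure] (h : littleGroup N q p) :
    μ.map (· * (h : SLxSL)) = μ := by
  obtain ⟨_, i, θ, rfl⟩ := h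
  exact map_mul_right_rot μ _ _

/-- The average of a function over the cosets of `H(N,q,p)`. -/
def cosetAverage (f : SLxSL → ℝ) (x : LittleQuotient N q p) : ℝ :=
  ∫ h : littleGroup N q p,
    f (Function.surjInv (isQuotientMap_littleQuotient_mk N q p).surjective x * h)
      ∂(littleMeasure N q p)

variable [NeZero N]

/-- Left invariance of `ν` makes the average independent of the chosen representative. -/
lemma cosetAverage_mk (f : SLxSL → ℝ) (g : SLxSL) :
    cosetAverage N q p f (LittleQuotient.mk N q p g) =
      ∫ h : littleGroup N q p, f (g * h) ∂(littleMeasure N q p) := by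
  have := isMulLeftInvariant_littleMeasure N q p
  have hs := Function.surjInv_eq (isQuotientMap_littleQuotient_mk N q p).surjective
    (LittleQuotient.mk N q p g)
  rw [eq_comm, littleQuotient_mk_eq_iff] at hs
  rw [cosetAverage]
  set s := Function.surjInv (isQuotientMap_littleQuotient_mk N q p).surjective
    (LittleQuotient.mk N q p g)
  rw [← integral_mul_left_eq_self (fun h : littleGroup N q p => f (g * h)) ⟨g⁻¹ * s, hs⟩]
  refine integral_congr_ae (Filter.Eventually.of_forall fun h => congrArg f ?_)
  change s * (h : SLxSL) = g * (g⁻¹ * s * h)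
  group

lemma continuous_cosetAverage {f : SLxSL → ℝ} (hf : Continuous f) :
    Continuous (cosetAverage N q p f) := by
  have := compactSpace_littleGroup N q p
  have := isProbabilityMeasure_littleMeasure N q p
  rw [(isQuotientMap_littleQuotient_mk N q p).continuous_iff]
  have h := continuous_parametric_integral_of_continuous (μ := littleMeasure N q p)
    (f := fun (g : SLxSL) (h : littleGroup N q p) => f (g * h))
    (hf.comp (continuous_fst.mul (continuous_subtype_val.comp continuous_snd))) isCompact_univ
  simp only [setIntegral_univ] at h
  exact h.congr fun g => (cosetAverage_mk N q p f g).symm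

lemma hasCompactSupport_cosetAverage [T2Space (LittleQuotient N q p)] {f : SLxSL → ℝ}
    (hf : HasCompactSupport f) : HasCompactSupport (cosetAverage N q p f) := by
  refine HasCompactSupport.intro
    (hf.isCompact.image (isQuotientMap_littleQuotient_mk N q p).continuous) fun x hx => ?_
  obtain ⟨g, rfl⟩ := (isQuotientMap_littleQuotient_mk N q p).surjective x
  rw [cosetAverage_mk]
  refine integral_eq_zero_of_ae (Filter.Eventually.of_forall fun h => ?_)
  refine image_eq_zero_of_notMem_tsupport fun hmem => hx ⟨_, hmem, ?_⟩
  rw [eq_comm, littleQuotient_mk_eq_iff, inv_mul_cancel_left]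
  exact h.2

lemma integrable_littleGroup {f : SLxSL → ℝ} (hf : Continuous f) (g : SLxSL) :
    Integrable (fun h : littleGroup N q p => f (g * h)) (littleMeasure N q p) := by
  have := compactSpace_littleGroup N q p
  have := isProbabilityMeasure_littleMeasure N q p
  exact (hf.comp (continuous_subtype_val.const_mul g)).integrable_of_hasCompactSupport
    (HasCompactSupport.of_compactSpace _)

lemma cosetAverage_comp_mul_left (f : SLxSL → ℝ) (g : SLxSL) (x : LittleQuotient N q p) :
    cosetAverage N q p (fun a => f (g * a)) x = cosetAverage N q p f (g • x) := by
  obtain ⟨a, rfl⟩ := (isQuotientMap_littleQuotient_mk N q p).surjective x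
  rw [smul_littleQuotient_mk, cosetAverage_mk, cosetAverage_mk]
  simp only [mul_assoc]

/-- Since `ν` has total mass `1`, every function on the coset space is the average of its own
pullback; this gives the test functions for uniqueness. -/
lemma cosetAverage_comp_mk (F : LittleQuotient N q p → ℝ) :
    cosetAverage N q p (F ∘ LittleQuotient.mk N q p) = F := by
  have := isProbabilityMeasure_littleMeasure N q p
  funext x
  obtain ⟨a, rfl⟩ := (isQuotientMap_littleQuotient_mk N q p).surjective x
  have h : ∀ h : littleGroup N q p,
      LittleQuotient.mk N q p (a * h) = LittleQuotient.mk N q p a := fun h => by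
    rw [eq_comm, littleQuotient_mk_eq_iff, inv_mul_cancel_left]
    exact h.2
  simp [cosetAverage_mk, h]

/-- Weil's formula for the image of a Haar measure. -/
lemma integral_cosetAverage_map (μ : Measure SLxSL) [μ.IsHaarMeasure] {f : SLxSL → ℝ}
    (hf : Continuous f) (hfc : HasCompactSupport f) :
    ∫ x, cosetAverage N q p f x ∂(μ.map (LittleQuotient.mk N q p)) = ∫ g, f g ∂μ := by
  have := compactSpace_littleGroup N q p
  have := isProbabilityMeasure_littleMeasure N q p
  have hmk := (isQuotientMap_littleQuotient_mk N q p).continuous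
  rw [integral_map hmk.measurable.aemeasurable
    (continuous_cosetAverage N q p hf).aestronglyMeasurable]
  simp only [cosetAverage_mk]
  rw [integral_integral_swap_of_hasCompactSupport (f := fun g (h : littleGroup N q p) => f (g * h))
    (hf.comp (continuous_fst.mul (continuous_subtype_val.comp continuous_snd)))]
  · have e : ∀ h : littleGroup N q p, ∫ g, f (g * h) ∂μ = ∫ g, f g ∂μ := fun h => by
      conv_rhs => rw [← map_mul_right_littleGroup N q p μ h]
      rw [integral_map (measurable_mul_const _).aemeasurable hf.aestronglyMeasurable]
    simp [e]
  -- Fubini needs compact support in both variables: the shear `(g, h) ↦ (gh, h)` reduces `f(gh)` to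
  -- `f(g)`, and `H` is compact.
  · let Φ : SLxSL × littleGroup N q p ≃ₜ SLxSL × littleGroup N q p :=
      { toFun := fun x => (x.1 * x.2, x.2)
        invFun := fun x => (x.1 * (x.2 : SLxSL)⁻¹, x.2)
        left_inv := fun x => by simp
        right_inv := fun x => by simp
        continuous_toFun := by fun_prop
        continuous_invFun := by fun_prop }
    have h1 : HasCompactSupport fun x : SLxSL × littleGroup N q p => f x.1 := by
      refine HasCompactSupport.intro (hfc.isCompact.prod isCompact_univ) fun x hx => ?_
      exact image_eq_zero_of_notMem_tsupport fun h => hx ⟨h, Set.mem_univ _⟩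
    exact h1.comp_homeomorph Φ

open scoped CompactlySupported in
/-- The functional `f ↦ ∫ (average of f) dm` on compactly supported functions. -/
def cosetFunctional [T2Space (LittleQuotient N q p)] (m : Measure (LittleQuotient N q p))
    [IsFiniteMeasureOnCompacts m] : C_c(SLxSL, ℝ) →ₚ[ℝ] ℝ :=
  PositiveLinearMap.mk₀
    { toFun := fun f => ∫ x, cosetAverage N q p f x ∂m
      map_add' := fun f g => by
        have hi : ∀ f : C_c(SLxSL, ℝ), Integrable (cosetAverage N q p f) m := fun f =>
          (continuous_cosetAverage N q p f.continuous).integrable_of_hasCompactSupport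
            (hasCompactSupport_cosetAverage N q p f.hasCompactSupport)
        rw [← integral_add (hi f) (hi g)]
        refine integral_congr_ae (Filter.Eventually.of_forall fun x => ?_)
        exact integral_add (integrable_littleGroup N q p f.continuous _)
          (integrable_littleGroup N q p g.continuous _)
      map_smul' := fun c f => by
        rw [RingHom.id_apply, ← integral_smul]
        refine integral_congr_ae (Filter.Eventually.of_forall fun x => ?_)
        exact integral_smul c _ }
    fun f hf => integral_nonneg fun x => integral_nonneg fun h => hf _

end

section

variable (N : ℕ) (q p : ℤ) [NeZero N]

/-- An invariant measure on the coset space lifts to a Haar measure up to a scalar. -/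
lemma exists_integral_cosetAverage_eq [T2Space (LittleQuotient N q p)]
    (m : Measure (LittleQuotient N q p)) [IsFiniteMeasureOnCompacts m]
    [SMulInvariantMeasure SLxSL (LittleQuotient N q p) m] (μ : Measure SLxSL) [μ.IsHaarMeasure] :
    ∃ c : NNReal, ∀ f : SLxSL → ℝ, Continuous f → HasCompactSupport f →
      ∫ x, cosetAverage N q p f x ∂m = c * ∫ g, f g ∂μ := by
  set Λ := cosetFunctional N q p m with hΛ
  -- The Riesz measure of the averaged functional inherits left invariance from `m`, so it is a
  -- multiple of `μ`.
  set μ' := RealRMK.rieszMeasure Λ with hμ'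
  have hreg : μ'.Regular := RealRMK.regular_rieszMeasure Λ
  have hint : ∀ f : SLxSL → ℝ, Continuous f → HasCompactSupport f →
      ∫ g, f g ∂μ' = ∫ x, cosetAverage N q p f x ∂m := fun f hf hfc =>
    RealRMK.integral_rieszMeasure Λ ⟨⟨f, hf⟩, hfc⟩
  have hinv : μ'.IsMulLeftInvariant := by
    refine ⟨fun g => ?_⟩
    have hr : (μ'.map (g * ·)).Regular := Measure.Regular.map (Homeomorph.mulLeft g)
    refine Measure.ext_of_integral_eq_on_compactlySupported fun f => ?_
    have hf : Continuous f := f.continuous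
    rw [integral_map (measurable_const_mul g).aemeasurable hf.aestronglyMeasurable,
      hint (fun a => f (g * a)) (f.continuous.comp (continuous_const_mul g))
        (f.hasCompactSupport.comp_homeomorph (Homeomorph.mulLeft g)),
      hint f f.continuous f.hasCompactSupport]
    simp only [cosetAverage_comp_mul_left]
    exact integral_smul_eq_self (μ := m) (cosetAverage N q p f)
  refine ⟨Measure.haarScalarFactor μ' μ, fun f hf hfc => ?_⟩
  rw [← hint f hf hfc, Measure.integral_isMulLeftInvariant_eq_smul_of_hasCompactSupport μ' μ hf hfc,
    integral_smul_nnreal_measure]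
  rfl

end

/-- The image of `μ` works directly: compactness of `H` makes the projection proper, so the image is
finite on compacts, and regularity follows on a metrizable, second countable, locally compact space.
-/
lemma exists_invariantMeasure {N : ℕ} {q p : ℤ} (hN0 : N ≠ 0) (hq0 : q ≠ 0)
    (hqp : IsCoprime q p) (μ : Measure SLxSL) [μ.IsHaarMeasure] :
    ∃ m : Measure (LittleQuotient N q p),
      m.Regular ∧ m ≠ 0 ∧ SMulInvariantMeasure SLxSL (LittleQuotient N q p) m ∧
      (∀ f : SLxSL → ℝ, Continuous f → HasCompactSupport f →
        ∃ F : LittleQuotient N q p → ℝ, Continuous F ∧ HasCompactSupport F ∧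
          (∀ g : SLxSL, F (LittleQuotient.mk N q p g) =
            ∫ h : littleGroup N q p, f (g * h) ∂(littleMeasure N q p)) ∧
          ∫ g, f g ∂μ = ∫ x, F x ∂m) ∧
      ∀ m' : Measure (LittleQuotient N q p), m'.Regular →
        SMulInvariantMeasure SLxSL (LittleQuotient N q p) m' → ∃ c : NNReal, m' = c • m := by
  have : NeZero N := ⟨hN0⟩
  obtain ⟨e, he⟩ := exists_homeomorph_littleQuotient (N := N) (p := p) hN0 hq0 hqp
  have : T2Space (LittleQuotient N q p) := e.symm.t2Space
  have : LocallyCompactSpace (LittleQuotient N q p) := e.isClosedEmbedding.locallyCompactSpace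
  have : SecondCountableTopology (LittleQuotient N q p) :=
    e.isEmbedding.secondCountableTopology
  have : TopologicalSpace.MetrizableSpace (LittleQuotient N q p) := e.isEmbedding.metrizableSpace
  have hc := (isQuotientMap_littleQuotient_mk N q p).continuous
  have hpre : ∀ K, IsCompact K → IsCompact (LittleQuotient.mk N q p ⁻¹' K) := fun K hK => by
    have := he.isCompact_preimage (hK.image e.continuous)
    rwa [Set.preimage_comp, e.preimage_image] at this
  set m := μ.map (LittleQuotient.mk N q p) with hm
  have hfin : IsFiniteMeasureOnCompacts m := ⟨fun K hK => by
    rw [hm, Measure.map_apply hc.measurable hK.measurableSet]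
    exact (hpre K hK).measure_lt_top⟩
  have hreg : m.Regular := inferInstance
  refine ⟨m, hreg, ?_, ⟨fun g s hs => ?_⟩, fun f hf hfc => ?_, fun m' hm' hi => ?_⟩
  · rw [hm, Ne, Measure.map_eq_zero_iff hc.measurable.aemeasurable]
    exact NeZero.ne μ
  · rw [hm, Measure.map_apply hc.measurable hs,
      Measure.map_apply hc.measurable (hs.preimage (continuous_const_smul g).measurable)]
    exact measure_preimage_mul μ g (LittleQuotient.mk N q p ⁻¹' s)
  · exact ⟨cosetAverage N q p f, continuous_cosetAverage N q p hf,
      hasCompactSupport_cosetAverage N q p hfc, cosetAverage_mk N q p f,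
      (integral_cosetAverage_map N q p μ hf hfc).symm⟩
  · obtain ⟨c, h⟩ := exists_integral_cosetAverage_eq N q p m' μ
    refine ⟨c, Measure.ext_of_integral_eq_on_compactlySupported fun F => ?_⟩
    have hF0 : Continuous F := F.continuous
    have hF : Continuous (F ∘ LittleQuotient.mk N q p) := F.continuous.comp hc
    -- Properness of the projection is needed here: the pullback of a compactly supported function
    -- is again compactly supported, hence a legitimate test function on `𝒢`.
    have hFc : HasCompactSupport (F ∘ LittleQuotient.mk N q p) := by
      refine HasCompactSupport.intro (hpre _ F.hasCompactSupport.isCompact) fun g hg => ?_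
      exact image_eq_zero_of_notMem_tsupport (f := F) hg
    have h1 := h _ hF hFc
    rw [cosetAverage_comp_mk] at h1
    rw [h1, integral_smul_nnreal_measure, hm,
      integral_map hc.measurable.aemeasurable hF0.aestronglyMeasurable]
    rfl

end

theorem mainTheorem6 (N : ℕ) (q p : ℤ) (hN : Odd N) (hq : Odd q) (hp : Odd p)
    (hqp : IsCoprime q p) :
    -- `Ad_𝒢` on the little group, in the basis `Ω₁, …, Ω₆` (row `j` gives the image of `Ω_j`)
    (∃ Ω : Module.Basis (Fin 3 ⊕ Fin 3) ℝ (lieAlg ⊤),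
      (∀ j, (Ω j : MatPair) = generator j) ∧
      ∀ (i : ℤ) (θ : ℝ), LinearMap.toMatrix Ω Ω (AdG (littleElt N q p i θ)) =
        (Matrix.fromBlocks (adBlock (q * θ)) 0 0
          (adBlock (p * θ + 2 * Real.pi / N * i))).transpose) ∧
    -- the criterion on the moduli of the determinants
    (∀ h : littleGroup N q p,
      LinearMap.det (AdG (h : SLxSL)) = 1 ∧
      AdRep (littleGroup N q p) h = LinearMap.id ∧
      |LinearMap.det (AdG (h : SLxSL))| = |LinearMap.det (AdRep (littleGroup N q p) h)|) ∧
    -- `dθ / 2π`, averaged over the `N` components, is the normalised Haar measure of `H(N,q,p)`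
    (littleMeasure N q p).IsHaarMeasure ∧ IsProbabilityMeasure (littleMeasure N q p) ∧
    -- the invariant measure on the coset space, obtained from the two Haar measures
    (∀ μ : Measure SLxSL, μ.IsHaarMeasure →
      ∃ m : Measure (LittleQuotient N q p),
        m.Regular ∧ m ≠ 0 ∧ SMulInvariantMeasure SLxSL (LittleQuotient N q p) m ∧
        (∀ f : SLxSL → ℝ, Continuous f → HasCompactSupport f →
          ∃ F : LittleQuotient N q p → ℝ, Continuous F ∧ HasCompactSupport F ∧
            (∀ g : SLxSL, F (LittleQuotient.mk N q p g) =
              ∫ h : littleGroup N q p, f (g * h) ∂(littleMeasure N q p)) ∧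
            ∫ g, f g ∂μ = ∫ x, F x ∂m) ∧
        ∀ m' : Measure (LittleQuotient N q p), m'.Regular →
          SMulInvariantMeasure SLxSL (LittleQuotient N q p) m' → ∃ c : NNReal, m' = c • m) ∧
    -- the homeomorphism type of the coset space and of the orbits of the dual action
    Nonempty (LittleQuotient N q p ≃ₜ EuclideanSpace ℝ (Fin 4) × Circle) ∧
    ∀ φ : L2Torus, MulAction.stabilizer SLxSL φ = littleGroup N q p →
      Nonempty (MulAction.orbit SLxSL φ ≃ₜ EuclideanSpace ℝ (Fin 4) × Circle) := by
  have hN0 : N ≠ 0 := by rintro rfl; simp at hN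
  have hq0 : q ≠ 0 := by rintro rfl; simp at hq
  have : NeZero N := ⟨hN0⟩
  refine ⟨⟨lieBasis, coe_lieBasis, fun i θ => toMatrix_AdG_rot _ _⟩, fun h => ?_,
    isHaarMeasure_littleMeasure N q p, isProbabilityMeasure_littleMeasure N q p,
    fun μ _ => exists_invariantMeasure hN0 hq0 hqp μ,
    ⟨(exists_homeomorph_littleQuotient hN0 hq0 hqp).choose⟩,
    fun φ hφ => nonempty_homeomorph_orbit hN0 hq0 hqp hφ⟩
  have h1 : LinearMap.det (AdG (h : SLxSL)) = 1 := by
    obtain ⟨_, i, θ, rfl⟩ := h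
    exact det_AdG_rot _ _
  refine ⟨h1, AdRep_littleGroup N q p h, ?_⟩
  rw [h1, AdRep_littleGroup, LinearMap.det_id]
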